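/- Let $\zeta$ be the Riemann zeta-function. For real-valued functions $f,g$ defined for all sufficiently large $T$, write $f(T)=\Omega(g(T))$ if there is a constant $c>0$ such that $|f(T)|>c\,|g(T)|$ for arbitrarily large real $T$ (equivalently, $f(T)=o(g(T))$ as $T\to\infty$ fails). Then for every fixed real $\delta>0$, unconditionally, (i) $\displaystyle \int_T^{T+\delta}|\zeta(1+it)|\,dt=\Omega(\log\log\log T)$ and $\displaystyle \int_T^{T+\delta}|\zeta(1+it)|^{-1}\,dt=\Omega(\log\log\log T)$; (ii) for every fixed real $p>1$, $\displaystyle \int_T^{T+\delta}|\zeta(1+it)|^{p}\,dt=\Omega\big((\log\log T)^{p-1}\big)$ and $\displaystyle \int_T^{T+\delta}|\zeta(1+it)|^{-p}\,dt=\Omega\big((\log\log T)^{p-1}\big)$. The implied constants may depend on $\delta$ and $p$. -/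

import Mathlib

/-- `IsOmegaAtTop f g`: the omega estimate `f(T) = Ω(g(T))` as `T → ∞`, i.e. there is a constant
`c > 0` such that `|f(T)| > c |g(T)|` for arbitrarily large `T`; in other words,
`f(T) = o(g(T))` fails. -/
def IsOmegaAtTop (f g : ℝ → ℝ) : Prop :=
  ∃ c : ℝ, 0 < c ∧ ∃ᶠ T in Filter.atTop, c * |g T| < |f T|

open Complex in
lemma norm_integral_exp_mul_I_le {c : ℝ} (hc : c ≠ 0) (A B : ℝ) :
    ‖∫ t in A..B, cexp (-(c * I) * t)‖ ≤ 2 / |c| := by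
  have hc' : (-(c * I) : ℂ) ≠ 0 := by simp [hc]
  rw [integral_exp_mul_complex hc', norm_div]
  have h1 : ∀ t : ℝ, ‖cexp (-(c * I) * t)‖ = 1 := by
    intro t
    rw [Complex.norm_exp]
    simp
  have h2 : ‖(-(c * I) : ℂ)‖ = |c| := by simp
  rw [h2]
  gcongr
  refine (norm_sub_le _ _).trans ?_
  rw [h1, h1]
  norm_num

open Complex in
lemma abs_integral_norm_sq_expSum_sub_le {ι : Type*} [DecidableEq ι] (S : Finset ι) (a : ι → ℂ)
    (l : ι → ℝ) (hl : Set.InjOn l S) (A B : ℝ) :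
    |(∫ t in A..B, ‖∑ i ∈ S, a i * cexp (-(l i * I) * t)‖ ^ 2) - (B - A) * ∑ i ∈ S, ‖a i‖ ^ 2| ≤
      ∑ i ∈ S, ∑ j ∈ S.erase i, ‖a i‖ * ‖a j‖ * (2 / |l i - l j|) := by
  have hsq : ∀ t : ℝ, ((‖∑ i ∈ S, a i * cexp (-(l i * I) * t)‖ ^ 2 : ℝ) : ℂ) =
      ∑ i ∈ S, ∑ j ∈ S, a i * (starRingEnd ℂ) (a j) *
        cexp (-(((l i - l j : ℝ) : ℂ) * I) * t) := by
    intro t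
    rw [ofReal_pow, ← Complex.mul_conj', map_sum, Finset.sum_mul_sum]
    refine Finset.sum_congr rfl fun i _ => Finset.sum_congr rfl fun j _ => ?_
    rw [map_mul, ← Complex.exp_conj]
    simp only [map_mul, map_neg, conj_ofReal, conj_I]
    rw [mul_mul_mul_comm, ← Complex.exp_add]
    congr 2
    push_cast
    ring
  have hint : ((∫ t in A..B, ‖∑ i ∈ S, a i * cexp (-(l i * I) * t)‖ ^ 2 : ℝ) : ℂ) =
      ∑ i ∈ S, ∑ j ∈ S, a i * (starRingEnd ℂ) (a j) *
        ∫ t in A..B, cexp (-(((l i - l j : ℝ) : ℂ) * I) * t) := by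
    rw [← intervalIntegral.integral_ofReal]
    simp_rw [hsq]
    rw [intervalIntegral.integral_finsetSum]
    · refine Finset.sum_congr rfl fun i _ => ?_
      rw [intervalIntegral.integral_finsetSum]
      · refine Finset.sum_congr rfl fun j _ => ?_
        rw [intervalIntegral.integral_const_mul]
      · intro j _
        exact Continuous.intervalIntegrable (by fun_prop) _ _
    · intro j _
      exact Continuous.intervalIntegrable (by fun_prop) _ _
  rw [← Real.norm_eq_abs, ← Complex.norm_real]
  push_cast
  rw [hint, Finset.mul_sum, ← Finset.sum_sub_distrib]
  refine (norm_sum_le _ _).trans (Finset.sum_le_sum fun i hi => ?_)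
  rw [← Finset.add_sum_erase S _ hi]
  have hd : a i * (starRingEnd ℂ) (a i) * ∫ t in A..B, cexp (-(((l i - l i : ℝ) : ℂ) * I) * t) =
      ((B : ℂ) - A) * (‖a i‖ : ℂ) ^ 2 := by
    rw [Complex.mul_conj']
    simp
    ring
  rw [hd, add_sub_cancel_left]
  refine (norm_sum_le _ _).trans (Finset.sum_le_sum fun j hj => ?_)
  rw [norm_mul, norm_mul, RCLike.norm_conj]
  gcongr
  refine norm_integral_exp_mul_I_le ?_ A B
  rw [Finset.mem_erase] at hj
  exact sub_ne_zero.2 fun h => hj.1 (hl hj.2 hi h.symm)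

lemma one_div_abs_log_sub_log_le {m n : ℕ} (hm : 0 < m) (hn : 0 < n) (hmn : m ≠ n) :
    1 / |Real.log m - Real.log n| ≤ max (m : ℝ) n / |(m : ℝ) - n| := by
  wlog h : n < m generalizing m n
  · have := this hn hm hmn.symm (by omega)
    rwa [abs_sub_comm, max_comm, abs_sub_comm (n : ℝ)] at this
  have hm' : (0 : ℝ) < m := by exact_mod_cast hm
  have hn' : (0 : ℝ) < n := by exact_mod_cast hn
  have h' : (n : ℝ) < m := by exact_mod_cast h
  have key : ((m : ℝ) - n) / m ≤ Real.log m - Real.log n := by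
    have := Real.add_one_le_exp (Real.log n - Real.log m)
    rw [Real.exp_sub, Real.exp_log hm', Real.exp_log hn'] at this
    rw [sub_div, div_self hm'.ne']
    linarith
  have h0 : 0 < ((m : ℝ) - n) / m := div_pos (by linarith) hm'
  rw [max_eq_left h'.le, abs_of_pos (show 0 < (m : ℝ) - n by linarith), abs_of_pos (h0.trans_le key)]
  calc 1 / (Real.log m - Real.log n) ≤ 1 / (((m : ℝ) - n) / m) := one_div_le_one_div_of_le h0 key
    _ = _ := by rw [one_div_div]

open Complex in
/-- Mean square of a Dirichlet polynomial whose frequencies are the logarithms of distinct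
integers up to `L`. -/
lemma abs_integral_norm_sq_dirichletPoly_sub_le {ι : Type*} [DecidableEq ι] (S : Finset ι)
    (a : ι → ℂ) (ν : ι → ℕ) (hν : Set.InjOn ν S) (L : ℝ) (hpos : ∀ i ∈ S, 0 < ν i)
    (hL : ∀ i ∈ S, (ν i : ℝ) ≤ L) (A B : ℝ) :
    |(∫ t in A..B, ‖∑ i ∈ S, a i * cexp (-((Real.log (ν i) : ℝ) * I) * t)‖ ^ 2) -
      (B - A) * ∑ i ∈ S, ‖a i‖ ^ 2| ≤ 2 * L * (∑ i ∈ S, ‖a i‖) ^ 2 := by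
  refine (abs_integral_norm_sq_expSum_sub_le S a (fun i => Real.log (ν i)) ?_ A B).trans ?_
  · intro i hi j hj hij
    refine hν hi hj ?_
    have := Real.log_injOn_pos (by simpa using hpos i hi) (by simpa using hpos j hj) hij
    exact_mod_cast this
  rw [sq, Finset.sum_mul_sum, Finset.mul_sum]
  refine Finset.sum_le_sum fun i hi => ?_
  rw [Finset.mul_sum]
  have hL0 : 0 ≤ L := (Nat.cast_nonneg _).trans (hL i hi)
  refine (Finset.sum_le_sum fun j hj => ?_).trans
    (Finset.sum_le_sum_of_subset_of_nonneg (Finset.erase_subset i S) fun j _ _ => by positivity)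
  rw [Finset.mem_erase] at hj
  have hne : ν i ≠ ν j := fun h => hj.1 (hν hj.2 hi h.symm)
  have h1 := one_div_abs_log_sub_log_le (hpos i hi) (hpos j hj.2) hne
  have h2 : max (ν i : ℝ) (ν j) / |(ν i : ℝ) - ν j| ≤ L := by
    have : (1 : ℝ) ≤ |(ν i : ℝ) - ν j| := by
      have h3 : (1 : ℤ) ≤ |(ν i : ℤ) - ν j| := Int.one_le_abs (by omega)
      exact_mod_cast h3
    exact (div_le_self (by positivity) this).trans (max_le (hL i hi) (hL j hj.2))
  calc ‖a i‖ * ‖a j‖ * (2 / |Real.log (ν i) - Real.log (ν j)|)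
      = 2 * (1 / |Real.log (ν i) - Real.log (ν j)|) * (‖a i‖ * ‖a j‖) := by ring
    _ ≤ 2 * L * (‖a i‖ * ‖a j‖) := by gcongr; exact h1.trans h2

lemma sum_Icc_one_div_le (L : ℕ) : ∑ n ∈ Finset.Icc 1 L, (1 : ℝ) / n ≤ 1 + Real.log L := by
  have := harmonic_le_one_add_log L
  rw [harmonic_eq_sum_Icc] at this
  push_cast at this
  simpa using this

lemma sum_one_div_abs_sub_le {S : Finset ℕ} {L m : ℕ} (hS : S ⊆ Finset.Icc 1 L)
    (hm : m ∈ Finset.Icc 1 L) :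
    ∑ n ∈ S.erase m, 1 / |(m : ℝ) - n| ≤ 2 * ∑ n ∈ Finset.Icc 1 L, (1 : ℝ) / n := by
  have hm' := Finset.mem_Icc.1 hm
  have hsub : S.erase m ⊆ (Finset.Icc 1 L).erase m := Finset.erase_subset_erase m hS
  refine (Finset.sum_le_sum_of_subset_of_nonneg hsub fun _ _ _ => by positivity).trans ?_
  have hsplit : (Finset.Icc 1 L).erase m = Finset.Ico 1 m ∪ Finset.Ioc m L := by
    ext n; simp only [Finset.mem_erase, Finset.mem_Icc, Finset.mem_union, Finset.mem_Ico,
      Finset.mem_Ioc]; omega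
  have hdisj : Disjoint (Finset.Ico 1 m) (Finset.Ioc m L) := by
    rw [Finset.disjoint_left]; intro n; simp only [Finset.mem_Ico, Finset.mem_Ioc]; omega
  rw [hsplit, Finset.sum_union hdisj, two_mul]
  refine add_le_add ?_ ?_
  · calc ∑ n ∈ Finset.Ico 1 m, 1 / |(m : ℝ) - n|
        = ∑ n ∈ (Finset.Ico 1 m).image (fun n => m - n), (1 : ℝ) / n := by
          rw [Finset.sum_image]
          · refine Finset.sum_congr rfl fun n hn => ?_
            rw [Finset.mem_Ico] at hn
            have : (n : ℝ) < m := by exact_mod_cast hn.2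
            rw [Nat.cast_sub hn.2.le, abs_of_pos (by linarith)]
          · intro a ha b hb hab
            simp only [Finset.coe_Ico, Set.mem_Ico] at ha hb
            simp only at hab
            omega
      _ ≤ _ := by
          refine Finset.sum_le_sum_of_subset_of_nonneg ?_ fun _ _ _ => by positivity
          intro n hn
          simp only [Finset.mem_image, Finset.mem_Ico] at hn
          obtain ⟨k, hk, rfl⟩ := hn
          rw [Finset.mem_Icc]; omega
  · calc ∑ n ∈ Finset.Ioc m L, 1 / |(m : ℝ) - n|
        = ∑ n ∈ (Finset.Ioc m L).image (fun n => n - m), (1 : ℝ) / n := by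
          rw [Finset.sum_image]
          · refine Finset.sum_congr rfl fun n hn => ?_
            rw [Finset.mem_Ioc] at hn
            have : (m : ℝ) < n := by exact_mod_cast hn.1
            rw [Nat.cast_sub hn.1.le, abs_sub_comm, abs_of_pos (by linarith)]
          · intro a ha b hb hab
            simp only [Finset.coe_Ioc, Set.mem_Ioc] at ha hb
            simp only at hab
            omega
      _ ≤ _ := by
          refine Finset.sum_le_sum_of_subset_of_nonneg ?_ fun _ _ _ => by positivity
          intro n hn
          simp only [Finset.mem_image, Finset.mem_Ioc] at hn
          obtain ⟨k, hk, rfl⟩ := hn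
          rw [Finset.mem_Icc]; omega

lemma sum_Ioc_one_div_sq_le {M : ℕ} (hM : 0 < M) (L : ℕ) :
    ∑ n ∈ Finset.Ioc M L, (1 : ℝ) / (n : ℝ) ^ 2 ≤ 1 / M := by
  have hM' : (0 : ℝ) < M := by exact_mod_cast hM
  rcases le_total M L with h | h
  · suffices H : ∑ n ∈ Finset.Ioc M L, (1 : ℝ) / (n : ℝ) ^ 2 ≤ 1 / M - 1 / L by
      have : (0 : ℝ) ≤ 1 / L := by positivity
      linarith
    induction L, h using Nat.le_induction with
    | base => simp
    | succ L hML ih =>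
      rw [Finset.sum_Ioc_succ_top (by omega)]
      have hL : (0 : ℝ) < L := by exact_mod_cast (by omega : 0 < L)
      have : (1 : ℝ) / ((L + 1 : ℕ) : ℝ) ^ 2 ≤ 1 / L - 1 / ((L + 1 : ℕ) : ℝ) := by
        push_cast
        rw [div_sub_div _ _ hL.ne' (by positivity), div_le_div_iff₀ (by positivity) (by positivity)]
        nlinarith
      linarith
  · rw [Finset.Ioc_eq_empty (by omega)]
    simp

open Complex in
/-- Mean square of a Dirichlet polynomial on the line `Re s = 1` supported above `M`. -/
lemma integral_norm_sq_dirichletTail_le {S : Finset ℕ} {M L : ℕ} (hM : 0 < M)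
    (hS : S ⊆ Finset.Ioc M L) (a : ℕ → ℂ) {K : ℝ} (ha : ∀ n ∈ S, ‖a n‖ ≤ K / n)
    {A B : ℝ} (hAB : A ≤ B) :
    ∫ t in A..B, ‖∑ n ∈ S, a n * cexp (-((Real.log n : ℝ) * I) * t)‖ ^ 2 ≤
      K ^ 2 * ((B - A) / M + 8 * (1 + Real.log L) ^ 2) := by
  have hS1 : S ⊆ Finset.Icc 1 L := fun n hn => by
    have := Finset.mem_Ioc.1 (hS hn); rw [Finset.mem_Icc]; omega
  have hpos : ∀ n ∈ S, 0 < n := fun n hn => (Finset.mem_Icc.1 (hS1 hn)).1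
  have h := abs_le.1 (abs_integral_norm_sq_expSum_sub_le S a (fun n => Real.log n) (by
    intro i hi j hj hij
    have := Real.log_injOn_pos (by simpa using hpos i hi) (by simpa using hpos j hj) hij
    exact_mod_cast this) A B) |>.2
  set H := ∑ n ∈ Finset.Icc 1 L, (1 : ℝ) / n with hH
  have hH0 : 0 ≤ H := Finset.sum_nonneg fun _ _ => by positivity
  have hHL : H ≤ 1 + Real.log L := sum_Icc_one_div_le L
  have hdiag : (B - A) * ∑ n ∈ S, ‖a n‖ ^ 2 ≤ K ^ 2 * ((B - A) / M) := by
    have : ∑ n ∈ S, ‖a n‖ ^ 2 ≤ K ^ 2 * (1 / M) := by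
      calc ∑ n ∈ S, ‖a n‖ ^ 2 ≤ ∑ n ∈ S, K ^ 2 * (1 / (n : ℝ) ^ 2) := by
            refine Finset.sum_le_sum fun n hn => ?_
            rw [mul_one_div, ← div_pow]
            exact pow_le_pow_left₀ (norm_nonneg _) (ha n hn) 2
        _ ≤ ∑ n ∈ Finset.Ioc M L, K ^ 2 * (1 / (n : ℝ) ^ 2) :=
            Finset.sum_le_sum_of_subset_of_nonneg hS fun _ _ _ => by positivity
        _ ≤ _ := by
            rw [← Finset.mul_sum]
            gcongr
            exact sum_Ioc_one_div_sq_le hM L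
    calc _ ≤ (B - A) * (K ^ 2 * (1 / M)) :=
          mul_le_mul_of_nonneg_left this (by linarith)
      _ = _ := by ring
  have hoff : ∑ i ∈ S, ∑ j ∈ S.erase i, ‖a i‖ * ‖a j‖ * (2 / |Real.log i - Real.log j|) ≤
      K ^ 2 * (8 * H ^ 2) := by
    have hterm : ∀ i ∈ S, ∀ j ∈ S.erase i,
        ‖a i‖ * ‖a j‖ * (2 / |Real.log i - Real.log j|) ≤
          2 * K ^ 2 * (1 / (i : ℝ) * (1 / |(i : ℝ) - j|)) +
          2 * K ^ 2 * (1 / (j : ℝ) * (1 / |(j : ℝ) - i|)) := by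
      intro i hi j hj
      rw [Finset.mem_erase] at hj
      have hi0 : (0 : ℝ) < i := by exact_mod_cast hpos i hi
      have hj0 : (0 : ℝ) < j := by exact_mod_cast hpos j hj.2
      have h1 := one_div_abs_log_sub_log_le (hpos i hi) (hpos j hj.2) (Ne.symm hj.1)
      have hd : 0 < |(i : ℝ) - j| := abs_pos.2 (sub_ne_zero.2 (by exact_mod_cast Ne.symm hj.1))
      have hK : 0 ≤ K / i := (norm_nonneg _).trans (ha i hi)
      calc ‖a i‖ * ‖a j‖ * (2 / |Real.log i - Real.log j|)
          = ‖a i‖ * ‖a j‖ * (2 * (1 / |Real.log i - Real.log j|)) := by ring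
        _ ≤ K / i * (K / j) * (2 * (max (i : ℝ) j / |(i : ℝ) - j|)) := by
            gcongr
            · exact mul_nonneg hK ((norm_nonneg _).trans (ha j hj.2))
            · exact ha i hi
            · exact ha j hj.2
        _ ≤ K / i * (K / j) * (2 * ((i + j) / |(i : ℝ) - j|)) := by
            have hKK : 0 ≤ K / i * (K / j) := mul_nonneg hK ((norm_nonneg _).trans (ha j hj.2))
            gcongr
            exact max_le (by linarith) (by linarith)
        _ = _ := by
            rw [abs_sub_comm (j : ℝ)]
            field_simp
            ring
    have hhalf : ∑ i ∈ S, ∑ j ∈ S.erase i, (1 / (i : ℝ) * (1 / |(i : ℝ) - j|)) ≤ 2 * H ^ 2 := by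
      calc _ = ∑ i ∈ S, 1 / (i : ℝ) * ∑ j ∈ S.erase i, (1 / |(i : ℝ) - j|) := by
            simp_rw [Finset.mul_sum]
        _ ≤ ∑ i ∈ S, 1 / (i : ℝ) * (2 * H) := by
            refine Finset.sum_le_sum fun i hi => ?_
            gcongr
            exact sum_one_div_abs_sub_le hS1 (hS1 hi)
        _ ≤ ∑ i ∈ Finset.Icc 1 L, 1 / (i : ℝ) * (2 * H) :=
            Finset.sum_le_sum_of_subset_of_nonneg hS1 fun _ _ _ => by positivity
        _ = 2 * H ^ 2 := by rw [← Finset.sum_mul]; ring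
    have hswap : ∑ i ∈ S, ∑ j ∈ S.erase i, (1 / (j : ℝ) * (1 / |(j : ℝ) - i|)) =
        ∑ i ∈ S, ∑ j ∈ S.erase i, (1 / (i : ℝ) * (1 / |(i : ℝ) - j|)) := by
      refine Finset.sum_comm' fun x z => ?_
      simp only [Finset.mem_erase]
      tauto
    calc _ ≤ ∑ i ∈ S, ∑ j ∈ S.erase i, (2 * K ^ 2 * (1 / (i : ℝ) * (1 / |(i : ℝ) - j|)) +
          2 * K ^ 2 * (1 / (j : ℝ) * (1 / |(j : ℝ) - i|))) :=
          Finset.sum_le_sum fun i hi => Finset.sum_le_sum fun j hj => hterm i hi j hj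
      _ = 4 * K ^ 2 * ∑ i ∈ S, ∑ j ∈ S.erase i, (1 / (i : ℝ) * (1 / |(i : ℝ) - j|)) := by
          rw [show (4 : ℝ) * K ^ 2 = 2 * K ^ 2 + 2 * K ^ 2 by ring, add_mul]
          nth_rewrite 2 [← hswap]
          simp only [Finset.sum_add_distrib, Finset.mul_sum]
      _ ≤ 4 * K ^ 2 * (2 * H ^ 2) := by gcongr
      _ = _ := by ring
  have hHsq : H ^ 2 ≤ (1 + Real.log L) ^ 2 := pow_le_pow_left₀ hH0 hHL 2
  nlinarith [mul_le_mul_of_nonneg_left hHsq (sq_nonneg K)]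

open Complex in
lemma norm_natCast_cpow_neg_sub_le {s : ℂ} (hs : 1 ≤ s.re) (hs1 : s ≠ 1) {n : ℕ} (hn : 0 < n) :
    ‖((n + 1 : ℕ) : ℂ) ^ (-s) -
      (((n + 1 : ℕ) : ℂ) ^ (1 - s) / (1 - s) - (n : ℂ) ^ (1 - s) / (1 - s))‖ ≤
      ‖s‖ * (4 / ((n + 1 : ℕ) : ℝ) ^ 2) := by
  have hn' : (1 : ℝ) ≤ n := by exact_mod_cast hn
  have h1s : 1 - s ≠ 0 := sub_ne_zero.2 hs1.symm
  have hs0 : s ≠ 0 := by rintro rfl; simp at hs; linarith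
  have hderiv : ∀ x : ℝ, 0 < x → HasDerivAt (fun y : ℝ => (y : ℂ) ^ (-s))
      (-s * (x : ℂ) ^ (-s - 1)) x := by
    intro x hx
    exact hasDerivAt_ofReal_cpow_const hx.ne' (neg_ne_zero.2 hs0)
  have hderiv2 : ∀ x : ℝ, 0 < x → HasDerivAt (fun y : ℝ => (y : ℂ) ^ (1 - s) / (1 - s))
      ((x : ℂ) ^ (-s)) x := by
    intro x hx
    have := hasDerivAt_ofReal_cpow_const' (r := -s) hx.ne' (by
      intro h
      apply hs1
      linear_combination -h)
    rwa [show -s + 1 = 1 - s by ring] at this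
  have hbd : ∀ x ∈ Set.Icc (n : ℝ) (n + 1), ‖(x : ℂ) ^ (-s) - ((n + 1 : ℝ) : ℂ) ^ (-s)‖ ≤
      ‖s‖ * (1 / (n : ℝ) ^ 2) := by
    intro x hx
    have hmv := (convex_Icc (n : ℝ) (n + 1)).norm_image_sub_le_of_norm_hasDerivWithin_le
      (f := fun y : ℝ => (y : ℂ) ^ (-s)) (f' := fun y : ℝ => -s * (y : ℂ) ^ (-s - 1))
      (C := ‖s‖ * (1 / (n : ℝ) ^ 2))
      (fun y hy => (hderiv y (by linarith [hy.1])).hasDerivWithinAt) (fun y hy => by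
        have hy0 : 0 < y := by linarith [hy.1]
        rw [norm_mul, norm_neg, Complex.norm_cpow_eq_rpow_re_of_pos hy0]
        gcongr
        rw [one_div, ← Real.rpow_natCast, ← Real.rpow_neg (by linarith)]
        calc y ^ (-s - 1).re ≤ y ^ (-((2 : ℕ) : ℝ)) := by
              apply Real.rpow_le_rpow_of_exponent_le (by linarith [hy.1])
              simp
              linarith
          _ ≤ (n : ℝ) ^ (-((2 : ℕ) : ℝ)) :=
              Real.rpow_le_rpow_of_nonpos (by linarith) hy.1 (by simp))
      (x := (n + 1 : ℝ)) (y := x) ⟨by linarith, le_rfl⟩ hx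
    refine hmv.trans ?_
    have : ‖x - (n + 1 : ℝ)‖ ≤ 1 := by
      rw [Real.norm_eq_abs, abs_le]; constructor <;> linarith [hx.1, hx.2]
    exact mul_le_of_le_one_right (by positivity) this
  have hmv := (convex_Icc (n : ℝ) (n + 1)).norm_image_sub_le_of_norm_hasDerivWithin_le
      (f := fun y : ℝ => (y : ℂ) ^ (1 - s) / (1 - s) - ((n + 1 : ℝ) : ℂ) ^ (-s) * y)
      (f' := fun y : ℝ => (y : ℂ) ^ (-s) - ((n + 1 : ℝ) : ℂ) ^ (-s))
      (C := ‖s‖ * (1 / (n : ℝ) ^ 2))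
      (fun y hy => by
        have h3 := ((hasDerivAt_id y).ofReal_comp).const_mul (((n + 1 : ℝ) : ℂ) ^ (-s))
        simpa using ((hderiv2 y (by linarith [hy.1])).fun_sub h3).hasDerivWithinAt)
      hbd (x := (n : ℝ)) (y := (n + 1 : ℝ)) ⟨le_rfl, by linarith⟩ ⟨by linarith, le_rfl⟩
  rw [add_sub_cancel_left, norm_one, mul_one] at hmv
  have h4 : (1 : ℝ) / (n : ℝ) ^ 2 ≤ 4 / ((n + 1 : ℕ) : ℝ) ^ 2 := by
    rw [div_le_div_iff₀ (by positivity) (by positivity)]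
    push_cast
    nlinarith
  refine le_trans (le_of_eq ?_) (hmv.trans (mul_le_mul_of_nonneg_left h4 (norm_nonneg _)))
  rw [← norm_neg]
  congr 1
  push_cast
  ring

open Complex in
lemma norm_sum_Ioc_cpow_neg_le {s : ℂ} (hs : 1 ≤ s.re) (hs1 : s ≠ 1) {N : ℕ} (hN : 0 < N)
    {K : ℕ} (hK : N ≤ K) :
    ‖∑ n ∈ Finset.Ioc N K, (n : ℂ) ^ (-s)‖ ≤ 2 / ‖s - 1‖ + 4 * ‖s‖ / N := by
  have key : ‖∑ n ∈ Finset.Ioc N K, (n : ℂ) ^ (-s) -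
      ((K : ℂ) ^ (1 - s) / (1 - s) - (N : ℂ) ^ (1 - s) / (1 - s))‖ ≤
      ‖s‖ * (4 * ∑ n ∈ Finset.Ioc N K, 1 / (n : ℝ) ^ 2) := by
    induction K, hK using Nat.le_induction with
    | base => simp
    | succ K hNK ih =>
      rw [Finset.sum_Ioc_succ_top (by omega), Finset.sum_Ioc_succ_top (by omega)]
      have := norm_natCast_cpow_neg_sub_le hs hs1 (n := K) (by omega)
      calc _ = ‖(∑ n ∈ Finset.Ioc N K, (n : ℂ) ^ (-s) -
              ((K : ℂ) ^ (1 - s) / (1 - s) - (N : ℂ) ^ (1 - s) / (1 - s))) +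
              (((K + 1 : ℕ) : ℂ) ^ (-s) - (((K + 1 : ℕ) : ℂ) ^ (1 - s) / (1 - s) -
                (K : ℂ) ^ (1 - s) / (1 - s)))‖ := by congr 1; ring
        _ ≤ _ := (norm_add_le _ _).trans (add_le_add ih this)
        _ = _ := by ring
  have hpow : ∀ m : ℕ, 0 < m → ‖(m : ℂ) ^ (1 - s) / (1 - s)‖ ≤ 1 / ‖s - 1‖ := by
    intro m hm
    rw [norm_div, norm_sub_rev 1 s, Complex.norm_natCast_cpow_of_pos hm]
    gcongr
    exact Real.rpow_le_one_of_one_le_of_nonpos (by exact_mod_cast hm) (by simpa using hs)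
  have h1 := hpow K (by omega)
  have h2 := hpow N hN
  have h3 := sum_Ioc_one_div_sq_le hN K
  have h4 : ‖s‖ * (4 * ∑ n ∈ Finset.Ioc N K, 1 / (n : ℝ) ^ 2) ≤ 4 * ‖s‖ / N := by
    calc _ ≤ ‖s‖ * (4 * (1 / N)) := by gcongr
      _ = _ := by ring
  calc _ = ‖(∑ n ∈ Finset.Ioc N K, (n : ℂ) ^ (-s) -
            ((K : ℂ) ^ (1 - s) / (1 - s) - (N : ℂ) ^ (1 - s) / (1 - s))) +
            ((K : ℂ) ^ (1 - s) / (1 - s) - (N : ℂ) ^ (1 - s) / (1 - s))‖ := by congr 1; ring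
    _ ≤ 4 * ‖s‖ / N + (1 / ‖s - 1‖ + 1 / ‖s - 1‖) :=
        (norm_add_le _ _).trans (add_le_add (key.trans h4)
          ((norm_sub_le _ _).trans (add_le_add h1 h2)))
    _ = _ := by ring

open Complex Filter Topology in
lemma norm_riemannZeta_sub_sum_le_of_one_lt {s : ℂ} (hs : 1 < s.re) {N : ℕ} (hN : 0 < N) :
    ‖riemannZeta s - ∑ n ∈ Finset.Icc 1 N, (n : ℂ) ^ (-s)‖ ≤ 2 / ‖s - 1‖ + 4 * ‖s‖ / N := by
  have hs1 : s ≠ 1 := by rintro rfl; simp at hs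
  have hsum : HasSum (fun n : ℕ => 1 / ((n : ℂ) + 1) ^ s) (riemannZeta s) := by
    rw [zeta_eq_tsum_one_div_nat_add_one_cpow hs]
    have := (Complex.summable_one_div_nat_cpow (p := s)).2 hs
    have h2 := (summable_nat_add_iff 1).2 this
    simp only [Nat.cast_add, Nat.cast_one] at h2
    exact h2.hasSum
  have htend : Tendsto (fun K : ℕ => ∑ n ∈ Finset.Icc 1 K, (n : ℂ) ^ (-s)) atTop
      (𝓝 (riemannZeta s)) := by
    refine hsum.tendsto_sum_nat.congr fun K => ?_
    rw [Finset.range_eq_Ico, Finset.sum_Ico_add' (fun n : ℕ => 1 / ((n : ℂ)) ^ s) 0 K 1 |>.symm.trans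
      (Finset.sum_congr rfl fun n _ => by push_cast; rfl) |>.symm]
    refine Finset.sum_congr ?_ fun n _ => ?_
    · ext n; simp only [Finset.mem_Ico, Finset.mem_Icc]; omega
    · rw [Complex.cpow_neg, one_div]
  refine le_of_tendsto (htend.sub_const _).norm ?_
  filter_upwards [eventually_ge_atTop N] with K hK
  have hsplit : ∑ n ∈ Finset.Icc 1 K, (n : ℂ) ^ (-s) - ∑ n ∈ Finset.Icc 1 N, (n : ℂ) ^ (-s) =
      ∑ n ∈ Finset.Ioc N K, (n : ℂ) ^ (-s) := by
    have : Finset.Icc 1 K = Finset.Icc 1 N ∪ Finset.Ioc N K := by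
      ext n; simp only [Finset.mem_Icc, Finset.mem_union, Finset.mem_Ioc]; omega
    rw [this, Finset.sum_union, add_sub_cancel_left]
    rw [Finset.disjoint_left]; intro n; simp only [Finset.mem_Icc, Finset.mem_Ioc]; omega
  rw [hsplit]
  exact norm_sum_Ioc_cpow_neg_le hs.le hs1 hN hK

open Complex Filter Topology in
lemma norm_riemannZeta_sub_sum_le {t : ℝ} (ht : t ≠ 0) {N : ℕ} (hN : 0 < N) :
    ‖riemannZeta (1 + I * t) - ∑ n ∈ Finset.Icc 1 N, (n : ℂ) ^ (-(1 + I * t))‖ ≤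
      2 / |t| + 4 * (1 + |t|) / N := by
  have hpath : Tendsto (fun σ : ℝ => (σ : ℂ) + I * t) (𝓝[>] 1) (𝓝 (1 + I * t)) := by
    refine Tendsto.mono_left ?_ nhdsWithin_le_nhds
    have : Continuous fun σ : ℝ => (σ : ℂ) + I * t := by fun_prop
    simpa using this.tendsto 1
  have hne : (1 + I * t : ℂ) ≠ 1 := by simp [ht]
  have hcont : ContinuousAt (fun s : ℂ => ‖riemannZeta s - ∑ n ∈ Finset.Icc 1 N, (n : ℂ) ^ (-s)‖)
      (1 + I * t) := by
    refine ((differentiableAt_riemannZeta hne).continuousAt.sub ?_).norm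
    refine Continuous.continuousAt (continuous_finsetSum _ fun n hn => ?_)
    have : (n : ℂ) ≠ 0 := by
      rw [Finset.mem_Icc] at hn; exact_mod_cast (by omega : n ≠ 0)
    exact continuous_neg.const_cpow (Or.inl this)
  have hcont2 : ContinuousAt (fun s : ℂ => 2 / ‖s - 1‖ + 4 * ‖s‖ / N) (1 + I * t) := by
    refine ContinuousAt.add (ContinuousAt.div (by fun_prop) (by fun_prop) ?_)
      (ContinuousAt.div (by fun_prop) (by fun_prop) ?_)
    · simp [ht]
    · exact_mod_cast hN.ne'
  have h := le_of_tendsto_of_tendsto (hcont.tendsto.comp hpath) (hcont2.tendsto.comp hpath) (by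
    filter_upwards [self_mem_nhdsWithin] with σ hσ
    exact norm_riemannZeta_sub_sum_le_of_one_lt (by simpa using hσ) hN)
  refine h.trans ?_
  have h1 : ‖(1 + I * t : ℂ) - 1‖ = |t| := by simp
  have h2 : ‖(1 + I * t : ℂ)‖ ≤ 1 + |t| := (norm_add_le _ _).trans (by simp)
  rw [h1]
  gcongr

open Filter Topology in
lemma exists_sum_primes_log_div_rpow_le : ∃ C r : ℝ, 0 < C ∧ 0 < r ∧ ∀ σ : ℝ, 1 < σ → σ < 1 + r →
    ∀ S : Finset ℕ, (∀ p ∈ S, p.Prime) →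
      ∑ p ∈ S, Real.log p * (p : ℝ) ^ (-σ) ≤ C / (σ - 1) := by
  obtain ⟨c, hc⟩ := log_deriv_riemannZeta_add_inv_sub_bounded.bound
  rw [eventually_nhdsWithin_iff, Metric.eventually_nhds_iff] at hc
  obtain ⟨r, hr, hc⟩ := hc
  refine ⟨1 + |c|, min r 1, by positivity, by positivity, fun σ h1 h2 S hS => ?_⟩
  have hσr : σ - 1 < r := by linarith [min_le_left r 1]
  have hσ1 : σ - 1 < 1 := by linarith [min_le_right r 1]
  have hσ0 : 0 < σ - 1 := by linarith
  have hre : 1 < (σ : ℂ).re := by simpa using h1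
  have hL := ArithmeticFunction.LSeries_vonMangoldt_eq_deriv_riemannZeta_div hre
  have hsum := ArithmeticFunction.LSeriesSummable_vonMangoldt hre
  have hterm : ∀ n : ℕ, LSeries.term (fun n => (ArithmeticFunction.vonMangoldt n : ℂ)) σ n =
      ((ArithmeticFunction.vonMangoldt n * (n : ℝ) ^ (-σ) : ℝ) : ℂ) := by
    intro n
    rcases Nat.eq_zero_or_pos n with rfl | hn
    · simp
    · rw [LSeries.term_of_ne_zero hn.ne', Real.rpow_neg (Nat.cast_nonneg _), ← div_eq_mul_inv]
      push_cast
      rw [Complex.ofReal_cpow (Nat.cast_nonneg _)]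
      simp
  have hsR : Summable fun n : ℕ => ArithmeticFunction.vonMangoldt n * (n : ℝ) ^ (-σ) := by
    rw [← Complex.summable_ofReal]
    exact hsum.congr fun n => (hterm n)
  have hLR : LSeries (fun n => (ArithmeticFunction.vonMangoldt n : ℂ)) σ =
      ((∑' n : ℕ, ArithmeticFunction.vonMangoldt n * (n : ℝ) ^ (-σ) : ℝ) : ℂ) := by
    rw [LSeries, Complex.ofReal_tsum]
    exact tsum_congr hterm
  have hle : ∑' n : ℕ, ArithmeticFunction.vonMangoldt n * (n : ℝ) ^ (-σ) ≤ |c| + 1 / (σ - 1) := by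
    have hb := hc (y := (σ : ℂ)) (by
      rw [dist_eq_norm, ← Complex.ofReal_one, ← Complex.ofReal_sub, Complex.norm_real,
        Real.norm_eq_abs, abs_of_pos hσ0]
      exact hσr) (by
      simp only [Set.mem_compl_iff, Set.mem_singleton_iff]
      intro h
      exact h1.ne' (by exact_mod_cast h))
    rw [norm_one, mul_one] at hb
    refine (le_abs_self _).trans ?_
    rw [← Real.norm_eq_abs, ← Complex.norm_real, ← hLR, hL]
    have h3 : ‖((σ : ℂ) - 1)⁻¹‖ = 1 / (σ - 1) := by
      rw [norm_inv, ← Complex.ofReal_one, ← Complex.ofReal_sub, Complex.norm_real,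
        Real.norm_eq_abs, abs_of_pos hσ0, one_div]
    calc _ = ‖-(deriv riemannZeta σ / riemannZeta σ + ((σ : ℂ) - 1)⁻¹) + ((σ : ℂ) - 1)⁻¹‖ := by
          congr 1; ring
      _ ≤ _ := (norm_add_le _ _).trans (by rw [norm_neg, h3]; linarith [le_abs_self c])
  calc ∑ p ∈ S, Real.log p * (p : ℝ) ^ (-σ)
      = ∑ p ∈ S, ArithmeticFunction.vonMangoldt p * (p : ℝ) ^ (-σ) :=
        Finset.sum_congr rfl fun p hp => by
          rw [ArithmeticFunction.vonMangoldt_apply_prime (hS p hp)]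
    _ ≤ ∑' n : ℕ, ArithmeticFunction.vonMangoldt n * (n : ℝ) ^ (-σ) :=
        hsR.sum_le_tsum S fun n _ => mul_nonneg ArithmeticFunction.vonMangoldt_nonneg (by positivity)
    _ ≤ |c| + 1 / (σ - 1) := hle
    _ ≤ |c| / (σ - 1) + 1 / (σ - 1) := by
        gcongr
        rw [le_div_iff₀ hσ0]
        exact mul_le_of_le_one_right (abs_nonneg _) hσ1.le
    _ = _ := by rw [← add_div, add_comm]

open Filter Topology in
lemma exists_half_le_norm_sub_one_mul_riemannZeta : ∃ r : ℝ, 0 < r ∧ ∀ s : ℂ, s ≠ 1 →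
    ‖s - 1‖ < r → 1 / 2 ≤ ‖s - 1‖ * ‖riemannZeta s‖ := by
  have h := (riemannZeta_residue_one.norm).eventually
    (lt_mem_nhds (show (1 / 2 : ℝ) < ‖(1 : ℂ)‖ by norm_num))
  rw [eventually_nhdsWithin_iff, Metric.eventually_nhds_iff] at h
  obtain ⟨r, hr, h⟩ := h
  refine ⟨r, hr, fun s hs hsr => ?_⟩
  have := h (y := s) (by rwa [dist_eq_norm]) hs
  rw [norm_mul] at this
  exact this.le

lemma rpow_neg_le_half {p : ℕ} (hp : 2 ≤ p) {σ : ℝ} (hσ : 1 ≤ σ) : (p : ℝ) ^ (-σ) ≤ 1 / 2 := by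
  have hp' : (2 : ℝ) ≤ p := by exact_mod_cast hp
  calc (p : ℝ) ^ (-σ) ≤ (p : ℝ) ^ (-1 : ℝ) :=
        Real.rpow_le_rpow_of_exponent_le (by linarith) (by linarith)
    _ = 1 / p := by rw [Real.rpow_neg_one, one_div]
    _ ≤ 1 / 2 := one_div_le_one_div_of_le (by norm_num) hp'

lemma norm_natCast_cpow_neg {p : ℕ} (hp : 0 < p) (s : ℂ) :
    ‖(p : ℂ) ^ (-s)‖ = (p : ℝ) ^ (-s.re) := by
  rw [Complex.norm_natCast_cpow_of_pos hp, Complex.neg_re]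

lemma half_le_norm_one_sub {z : ℂ} (hz : ‖z‖ ≤ 1 / 2) : 1 / 2 ≤ ‖1 - z‖ := by
  have := norm_sub_norm_le (1 : ℂ) z
  rw [norm_one] at this
  linarith

open Complex in
/-- Euler factors on the line `Re s = 1` compared with those slightly to the right of it. -/
lemma norm_one_sub_cpow_le {p : ℕ} (hp : 2 ≤ p) {κ : ℝ} (hκ : 0 < κ) (u : ℝ) :
    ‖1 - (p : ℂ) ^ (-(1 + I * u))‖ ≤
      ‖1 - (p : ℂ) ^ (-((1 + κ : ℝ) + I * u))‖ * Real.exp (2 * (κ * (Real.log p * (p : ℝ)⁻¹))) := by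
  have hp0 : (0 : ℝ) < p := by exact_mod_cast (by omega : 0 < p)
  have hpC : (p : ℂ) ≠ 0 := by exact_mod_cast (by omega : p ≠ 0)
  have hre : ((1 + κ : ℝ) + I * u : ℂ).re = 1 + κ := by simp
  have hhalf := half_le_norm_one_sub (z := (p : ℂ) ^ (-((1 + κ : ℝ) + I * u))) (by
    rw [norm_natCast_cpow_neg (by omega), hre]
    exact rpow_neg_le_half hp (by linarith))
  have hdiff : ‖(p : ℂ) ^ (-((1 + κ : ℝ) + I * u)) - (p : ℂ) ^ (-(1 + I * u))‖ ≤
      κ * (Real.log p * (p : ℝ)⁻¹) := by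
    have h1 : (p : ℂ) ^ (-((1 + κ : ℝ) + I * u)) =
        (p : ℂ) ^ (-(1 + I * u)) * (((p : ℝ) ^ (-κ) : ℝ) : ℂ) := by
      rw [ofReal_cpow hp0.le, ofReal_natCast, ← cpow_add _ _ hpC]
      congr 1
      push_cast
      ring
    rw [h1, ← mul_sub_one, norm_mul, norm_natCast_cpow_neg (by omega), ← ofReal_one, ← ofReal_sub,
      norm_real, Real.norm_eq_abs]
    have h2 : (p : ℝ) ^ (-κ) ≤ 1 :=
      Real.rpow_le_one_of_one_le_of_nonpos (by exact_mod_cast (by omega : 1 ≤ p)) (by linarith)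
    have h3 : 1 - κ * Real.log p ≤ (p : ℝ) ^ (-κ) := by
      rw [Real.rpow_def_of_pos hp0]
      have := Real.add_one_le_exp (Real.log p * -κ)
      linarith
    rw [abs_of_nonpos (by linarith)]
    have h4 : (1 + I * u : ℂ).re = 1 := by simp
    rw [ofReal_one, h4, Real.rpow_neg_one]
    calc (p : ℝ)⁻¹ * -((p : ℝ) ^ (-κ) - 1) ≤ (p : ℝ)⁻¹ * (κ * Real.log p) := by
          gcongr; linarith
      _ = _ := by ring
  have hnn : 0 ≤ κ * (Real.log p * (p : ℝ)⁻¹) := (norm_nonneg _).trans hdiff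
  set w := (p : ℂ) ^ (-((1 + κ : ℝ) + I * u))
  calc ‖1 - (p : ℂ) ^ (-(1 + I * u))‖
      = ‖(1 - w) + (w - (p : ℂ) ^ (-(1 + I * u)))‖ := by congr 1; ring
    _ ≤ ‖1 - w‖ + κ * (Real.log p * (p : ℝ)⁻¹) := (norm_add_le _ _).trans (by gcongr)
    _ ≤ ‖1 - w‖ + ‖1 - w‖ * (2 * (κ * (Real.log p * (p : ℝ)⁻¹))) := by
        linarith [mul_le_mul_of_nonneg_right hhalf hnn]
    _ = ‖1 - w‖ * (2 * (κ * (Real.log p * (p : ℝ)⁻¹)) + 1) := by ring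
    _ ≤ _ := by gcongr; exact Real.add_one_le_exp _

open Filter Topology in
/-- If the primes above `y` contribute at most `K` to the prime zeta sum, then the partial Euler
product up to `y` controls `ζ`. -/
lemma norm_riemannZeta_mul_prod_primesBelow_le {s : ℂ} (hs : 1 < s.re) {y : ℕ} {K : ℝ}
    (hK : ∀ S : Finset ℕ, (∀ p ∈ S, p.Prime ∧ y < p) → ∑ p ∈ S, (p : ℝ) ^ (-s.re) ≤ K) :
    ‖riemannZeta s‖ * ∏ p ∈ (y + 1).primesBelow, ‖1 - (p : ℂ) ^ (-s)‖ ≤ Real.exp (2 * K) := by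
  refine le_of_tendsto ((riemannZeta_eulerProduct hs).norm.mul_const _) ?_
  filter_upwards [eventually_ge_atTop (y + 1)] with n hn
  have hsub : (y + 1).primesBelow ⊆ n.primesBelow := fun p hp => by
    rw [Nat.mem_primesBelow] at hp ⊢; exact ⟨by omega, hp.2⟩
  have hne : ∀ p ∈ n.primesBelow, 1 / 2 ≤ ‖1 - (p : ℂ) ^ (-s)‖ := fun p hp => by
    have hp := (Nat.mem_primesBelow.1 hp).2
    refine half_le_norm_one_sub ?_
    rw [norm_natCast_cpow_neg hp.pos]
    exact rpow_neg_le_half hp.two_le hs.le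
  rw [norm_prod, ← Finset.prod_sdiff hsub, mul_assoc, ← Finset.prod_mul_distrib]
  rw [Finset.prod_eq_one (s := (y + 1).primesBelow) fun p hp => by
    rw [norm_inv, inv_mul_cancel₀]
    have := hne p (hsub hp)
    positivity, mul_one]
  have hprime : ∀ p ∈ n.primesBelow \ (y + 1).primesBelow, p.Prime ∧ y < p := fun p hp => by
    simp only [Finset.mem_sdiff, Nat.mem_primesBelow, not_and] at hp
    exact ⟨hp.1.2, by by_contra h; exact hp.2 (by omega) hp.1.2⟩
  calc ∏ p ∈ n.primesBelow \ (y + 1).primesBelow, ‖(1 - (p : ℂ) ^ (-s))⁻¹‖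
      ≤ ∏ p ∈ n.primesBelow \ (y + 1).primesBelow, Real.exp (2 * (p : ℝ) ^ (-s.re)) := by
        refine Finset.prod_le_prod (fun _ _ => norm_nonneg _) fun p hp => ?_
        have hp' := (hprime p hp).1
        have hx := rpow_neg_le_half hp'.two_le hs.le
        have hx0 : 0 ≤ (p : ℝ) ^ (-s.re) := by positivity
        have h1 : 1 - (p : ℝ) ^ (-s.re) ≤ ‖1 - (p : ℂ) ^ (-s)‖ := by
          have := norm_sub_norm_le (1 : ℂ) ((p : ℂ) ^ (-s))
          rwa [norm_one, norm_natCast_cpow_neg hp'.pos] at this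
        have h2 := Real.add_one_le_exp (2 * (p : ℝ) ^ (-s.re))
        rw [norm_inv, inv_le_comm₀ (by linarith) (Real.exp_pos _)]
        refine le_trans ?_ h1
        rw [inv_le_comm₀ (Real.exp_pos _) (by linarith)]
        refine le_trans ?_ h2
        rw [inv_le_iff_one_le_mul₀ (by linarith)]
        nlinarith
    _ = Real.exp (2 * ∑ p ∈ n.primesBelow \ (y + 1).primesBelow, (p : ℝ) ^ (-s.re)) := by
        rw [← Real.exp_sum, Finset.mul_sum]
    _ ≤ _ := by
        rw [Real.exp_le_exp]
        linarith [hK _ hprime]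

open Complex in
lemma exists_prod_primesBelow_le : ∃ C r : ℝ, 0 < C ∧ 0 < r ∧ ∀ y : ℕ, 1 / r < Real.log y →
    ∀ u : ℝ, |u| < r →
      ∏ p ∈ (y + 1).primesBelow, ‖1 - (p : ℂ) ^ (-(1 + I * u))‖ ≤ C * (1 / Real.log y + |u|) := by
  obtain ⟨C, r₁, hC, hr₁, hlog⟩ := exists_sum_primes_log_div_rpow_le
  obtain ⟨r₂, hr₂, hζ⟩ := exists_half_le_norm_sub_one_mul_riemannZeta
  refine ⟨2 * Real.exp (2 * C) * Real.exp (2 * (Real.exp 1 * C)), min r₁ (r₂ / 2), by positivity,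
    by positivity, fun y hy u hu => ?_⟩
  set r := min r₁ (r₂ / 2) with hr
  have hr0 : 0 < r := by positivity
  have hl0 : 0 < Real.log y := (one_div_pos.2 hr0).trans hy
  set κ := 1 / Real.log y with hκ
  have hκ0 : 0 < κ := one_div_pos.2 hl0
  have hκr : κ < r := by rwa [hκ, one_div_lt hl0 hr0]
  have hy0 : (0 : ℝ) < y := by
    rcases Nat.eq_zero_or_pos y with rfl | h
    · simp at hl0
    · exact_mod_cast h
  set s : ℂ := (1 + κ : ℝ) + I * u with hs
  have hre : s.re = 1 + κ := by simp [hs]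
  have hs1 : s - 1 = κ + I * u := by rw [hs]; push_cast; ring
  have hnorm : ‖s - 1‖ ≤ κ + |u| := by
    rw [hs1]
    refine (norm_add_le _ _).trans ?_
    simp [abs_of_pos hκ0]
  have hsne : s ≠ 1 := fun h => by
    have := congrArg Complex.re h
    rw [hre] at this
    simp at this
    linarith
  have hζs := hζ s hsne (by linarith [min_le_right r₁ (r₂ / 2)])
  have hbig : ∀ S : Finset ℕ, (∀ p ∈ S, p.Prime) → ∑ p ∈ S, Real.log p * (p : ℝ) ^ (-s.re) ≤ C / κ := by
    intro S hS
    have := hlog (1 + κ) (by linarith) (by linarith [min_le_left r₁ (r₂ / 2)]) S hS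
    rwa [add_sub_cancel_left, ← hre] at this
  have htail := norm_riemannZeta_mul_prod_primesBelow_le (s := s) (y := y) (K := C)
    (by rw [hre]; linarith) (by
      intro S hS
      have h1 := hbig S fun p hp => (hS p hp).1
      rw [le_div_iff₀ hκ0, Finset.sum_mul] at h1
      refine le_trans (Finset.sum_le_sum fun p hp => ?_) h1
      have h2 : Real.log y ≤ Real.log p :=
        Real.log_le_log hy0 (by exact_mod_cast (hS p hp).2.le)
      have h3 : 1 ≤ Real.log p * κ := by
        rw [hκ, mul_one_div, le_div_iff₀ hl0]; linarith
      calc (p : ℝ) ^ (-s.re) ≤ (Real.log p * κ) * (p : ℝ) ^ (-s.re) :=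
            le_mul_of_one_le_left (by positivity) h3
        _ = _ := by ring)
  have hprod : ∏ p ∈ (y + 1).primesBelow, ‖1 - (p : ℂ) ^ (-(1 + I * u))‖ ≤
      (∏ p ∈ (y + 1).primesBelow, ‖1 - (p : ℂ) ^ (-s)‖) * Real.exp (2 * (Real.exp 1 * C)) := by
    calc _ ≤ ∏ p ∈ (y + 1).primesBelow, (‖1 - (p : ℂ) ^ (-s)‖ *
            Real.exp (2 * (κ * (Real.log p * (p : ℝ)⁻¹)))) :=
          Finset.prod_le_prod (fun _ _ => norm_nonneg _) fun p hp =>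
            norm_one_sub_cpow_le (Nat.mem_primesBelow.1 hp).2.two_le hκ0 u
      _ = (∏ p ∈ (y + 1).primesBelow, ‖1 - (p : ℂ) ^ (-s)‖) *
            Real.exp (2 * (κ * ∑ p ∈ (y + 1).primesBelow, Real.log p * (p : ℝ)⁻¹)) := by
          rw [Finset.prod_mul_distrib, ← Real.exp_sum]
          simp only [Finset.mul_sum]
      _ ≤ _ := by
          refine mul_le_mul_of_nonneg_left (Real.exp_le_exp.2 (mul_le_mul_of_nonneg_left ?_
            zero_le_two)) (Finset.prod_nonneg fun _ _ => norm_nonneg _)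
          have h1 := hbig (y + 1).primesBelow fun p hp => (Nat.mem_primesBelow.1 hp).2
          rw [le_div_iff₀' hκ0] at h1
          refine le_trans ?_ (mul_le_mul_of_nonneg_left h1 (Real.exp_pos 1).le)
          rw [mul_left_comm]
          refine mul_le_mul_of_nonneg_left ?_ hκ0.le
          rw [Finset.mul_sum]
          refine Finset.sum_le_sum fun p hp => ?_
          have hp' := Nat.mem_primesBelow.1 hp
          have hp0 : (0 : ℝ) < p := by exact_mod_cast hp'.2.pos
          have hlp : 0 ≤ Real.log p := Real.log_natCast_nonneg p
          have h2 : (p : ℝ)⁻¹ ≤ Real.exp 1 * (p : ℝ) ^ (-s.re) := by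
            rw [hre, neg_add, Real.rpow_add hp0, Real.rpow_neg_one, mul_left_comm]
            refine le_mul_of_one_le_right (by positivity) ?_
            rw [Real.rpow_def_of_pos hp0, ← Real.exp_add, Real.one_le_exp_iff]
            have h3 : Real.log p ≤ Real.log y :=
              Real.log_le_log hp0 (by exact_mod_cast (by omega : p ≤ y))
            have h4 : Real.log p * κ ≤ 1 := by
              rw [hκ, mul_one_div, div_le_one hl0]; exact h3
            linarith
          calc Real.log p * (p : ℝ)⁻¹ ≤ Real.log p * (Real.exp 1 * (p : ℝ) ^ (-s.re)) := by gcongr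
            _ = _ := by ring
  set P := ∏ p ∈ (y + 1).primesBelow, ‖1 - (p : ℂ) ^ (-s)‖
  have hP0 : 0 ≤ P := Finset.prod_nonneg fun _ _ => norm_nonneg _
  have hPle : P ≤ 2 * Real.exp (2 * C) * (κ + |u|) := by
    calc P ≤ 2 * (‖s - 1‖ * ‖riemannZeta s‖) * P := le_mul_of_one_le_left hP0 (by linarith)
      _ = 2 * ‖s - 1‖ * (‖riemannZeta s‖ * P) := by ring
      _ ≤ 2 * (κ + |u|) * Real.exp (2 * C) := by gcongr
      _ = _ := by ring
  calc _ ≤ P * Real.exp (2 * (Real.exp 1 * C)) := hprod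
    _ ≤ 2 * Real.exp (2 * C) * (κ + |u|) * Real.exp (2 * (Real.exp 1 * C)) := by gcongr
    _ = _ := by ring

open ArithmeticFunction in
/-- The completely multiplicative function `n ↦ ε ^ Ω(n) * n ^ (-it)`. -/
noncomputable def twist (ε : ℂ) (t : ℝ) (n : ℕ) : ℂ :=
  ε ^ cardFactors n * Complex.exp (-((Real.log n : ℝ) * Complex.I) * t)

/-- The resonator: the sum of `ε ^ Ω(r) * r ^ (-it)` over the divisors `r` of `Q`. -/
noncomputable def resonator (ε : ℂ) (Q : ℕ) (t : ℝ) : ℂ := ∑ r ∈ Q.divisors, twist ε t r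

lemma continuous_twist (ε : ℂ) (n : ℕ) : Continuous fun t => twist ε t n := by
  unfold twist; fun_prop

lemma continuous_resonator (ε : ℂ) (Q : ℕ) : Continuous (resonator ε Q) :=
  continuous_finsetSum _ fun r _ => continuous_twist ε r

lemma twist_mul (ε : ℂ) (t : ℝ) {m n : ℕ} (hm : m ≠ 0) (hn : n ≠ 0) :
    twist ε t (m * n) = twist ε t m * twist ε t n := by
  unfold twist
  rw [ArithmeticFunction.cardFactors_mul hm hn, Nat.cast_mul,
    Real.log_mul (by exact_mod_cast hm) (by exact_mod_cast hn), mul_mul_mul_comm, ← Complex.exp_add,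
    pow_add]
  congr 2
  push_cast
  ring

lemma twist_one (ε : ℂ) (t : ℝ) : twist ε t 1 = 1 := by simp [twist]

lemma twist_pow (ε : ℂ) (t : ℝ) {n : ℕ} (hn : n ≠ 0) (j : ℕ) :
    twist ε t (n ^ j) = twist ε t n ^ j := by
  induction j with
  | zero => simp [twist_one]
  | succ j ih => rw [pow_succ, twist_mul ε t (pow_ne_zero j hn) hn, ih, pow_succ]

lemma norm_twist {ε : ℂ} (hε : ‖ε‖ = 1) (t : ℝ) (n : ℕ) : ‖twist ε t n‖ = 1 := by
  unfold twist
  rw [norm_mul, norm_pow, hε, one_pow, one_mul,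
    show -((Real.log n : ℝ) * Complex.I) * (t : ℂ) = ((-(Real.log n * t) : ℝ) : ℂ) * Complex.I by
      push_cast; ring, Complex.norm_exp_ofReal_mul_I]

lemma norm_resonator_le {ε : ℂ} (hε : ‖ε‖ = 1) (Q : ℕ) (t : ℝ) :
    ‖resonator ε Q t‖ ≤ Q.divisors.card := by
  refine (norm_sum_le _ _).trans ?_
  simp [norm_twist hε]

lemma divisors_mul_eq_image (m n : ℕ) :
    (m * n).divisors = (m.divisors ×ˢ n.divisors).image fun x => x.1 * x.2 := by
  rw [Nat.divisors_mul, Finset.mul_def]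

/-- Multiplying the resonator by `1 - ε p ^ (-it)` telescopes the factor at `p`. -/
lemma one_sub_twist_mul_resonator (ε : ℂ) (t : ℝ) {p : ℕ} (hp : p.Prime) (v : ℕ) {Q : ℕ}
    (hpQ : Nat.Coprime p Q) :
    (1 - twist ε t p) * resonator ε (p ^ v * Q) t =
      (1 - twist ε t p ^ (v + 1)) * resonator ε Q t := by
  have hcop : Nat.Coprime (p ^ v) Q := Nat.Coprime.pow_left v hpQ
  have hmul : resonator ε (p ^ v * Q) t =
      (∑ j ∈ Finset.range (v + 1), twist ε t p ^ j) * resonator ε Q t := by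
    unfold resonator
    rw [divisors_mul_eq_image, Finset.sum_image hcop.mul_injOn_divisors, Finset.sum_product]
    rw [Nat.sum_divisors_prime_pow hp, Finset.sum_mul]
    refine Finset.sum_congr rfl fun j _ => ?_
    rw [Finset.mul_sum]
    refine Finset.sum_congr rfl fun r hr => ?_
    have hr0 : r ≠ 0 := (Nat.pos_of_mem_divisors hr).ne'
    rw [twist_mul ε t (pow_ne_zero j hp.ne_zero) hr0, twist_pow ε t hp.ne_zero]
  rw [hmul, ← mul_assoc, mul_neg_geom_sum]

lemma abs_integral_norm_sq_resonator_sub_le {ε : ℂ} (hε : ‖ε‖ = 1) (Q : ℕ) (A B : ℝ) :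
    |(∫ t in A..B, ‖resonator ε Q t‖ ^ 2) - (B - A) * Q.divisors.card| ≤
      2 * Q * (Q.divisors.card : ℝ) ^ 2 := by
  have := abs_integral_norm_sq_dirichletPoly_sub_le Q.divisors
    (fun r => ε ^ ArithmeticFunction.cardFactors r) id (fun _ _ _ _ h => h) Q
    (fun r hr => Nat.pos_of_mem_divisors hr) (fun r hr => by exact_mod_cast Nat.divisor_le hr) A B
  simpa [hε, resonator, twist] using this

/-- Under the weight `|resonator|²`, the number `ε p ^ (-it)` concentrates at `1`. -/
lemma integral_norm_sq_resonator_mul_one_sub_twist_le {ε : ℂ} (hε : ‖ε‖ = 1) {Q p k : ℕ}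
    (hQ : Q ≠ 0) (hp : p.Prime) (hk : p ^ k ∣ Q) {A B : ℝ} (hAB : A ≤ B) :
    ∫ t in A..B, ‖resonator ε Q t‖ ^ 2 * ‖1 - twist ε t p‖ ^ 2 ≤
      4 * ((B - A) * Q.divisors.card / (k + 1) + 2 * Q * (Q.divisors.card : ℝ) ^ 2) := by
  obtain ⟨v, Q', hpQ', rfl⟩ := Nat.exists_eq_pow_mul_and_not_dvd hQ p hp.ne_one
  have hQ' : Q' ≠ 0 := by rintro rfl; simp at hQ
  have hcop : Nat.Coprime p Q' := (hp.coprime_iff_not_dvd).2 hpQ'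
  have hkv : k ≤ v := by
    rw [(Nat.Coprime.pow_left k hcop).dvd_mul_right] at hk
    exact (Nat.pow_dvd_pow_iff_le_right hp.one_lt).1 hk
  have hcard : (p ^ v * Q').divisors.card = (v + 1) * Q'.divisors.card := by
    rw [Nat.Coprime.card_divisors_mul (Nat.Coprime.pow_left v hcop), Nat.divisors_prime_pow hp]
    simp
  have hpt : ∀ t : ℝ, ‖resonator ε (p ^ v * Q') t‖ ^ 2 * ‖1 - twist ε t p‖ ^ 2 ≤
      4 * ‖resonator ε Q' t‖ ^ 2 := by
    intro t
    rw [← mul_pow, ← norm_mul, mul_comm, one_sub_twist_mul_resonator ε t hp v hcop, norm_mul,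
      mul_pow]
    gcongr
    have : ‖1 - twist ε t p ^ (v + 1)‖ ≤ 2 := by
      refine (norm_sub_le _ _).trans ?_
      rw [norm_one, norm_pow, norm_twist hε, one_pow]
      norm_num
    nlinarith [norm_nonneg (1 - twist ε t p ^ (v + 1))]
  have hres := (abs_le.1 (abs_integral_norm_sq_resonator_sub_le hε Q' A B)).2
  set D' : ℝ := (Q'.divisors.card : ℝ) with hD'
  have hD'0 : 0 ≤ D' := Nat.cast_nonneg _
  have hDv : ((p ^ v * Q').divisors.card : ℝ) = (v + 1) * D' := by rw [hcard]; push_cast; rfl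
  have hDk : D' ≤ ((p ^ v * Q').divisors.card : ℝ) / (k + 1) := by
    rw [hDv, le_div_iff₀ (by positivity), mul_comm]
    have : (k : ℝ) ≤ v := by exact_mod_cast hkv
    gcongr
  have hDD : D' ≤ ((p ^ v * Q').divisors.card : ℝ) := by
    rw [hDv]; exact le_mul_of_one_le_left hD'0 (by linarith [(Nat.cast_nonneg v : (0 : ℝ) ≤ v)])
  have hQQ : (Q' : ℝ) ≤ ((p ^ v * Q' : ℕ) : ℝ) := by
    exact_mod_cast Nat.le_mul_of_pos_left _ (pow_pos hp.pos v)
  calc _ ≤ ∫ t in A..B, 4 * ‖resonator ε Q' t‖ ^ 2 := by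
        refine intervalIntegral.integral_mono hAB ?_ ?_ hpt
        · exact Continuous.intervalIntegrable (((continuous_resonator _ _).norm.pow 2).mul
            ((continuous_const.sub (continuous_twist ε p)).norm.pow 2)) _ _
        · exact Continuous.intervalIntegrable
            (continuous_const.mul ((continuous_resonator _ _).norm.pow 2)) _ _
    _ = 4 * ∫ t in A..B, ‖resonator ε Q' t‖ ^ 2 := intervalIntegral.integral_const_mul _ _
    _ ≤ 4 * ((B - A) * D' + 2 * Q' * D' ^ 2) := by linarith
    _ ≤ _ := by
        rw [mul_div_assoc]
        have : 0 ≤ B - A := by linarith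
        gcongr

open Complex in
/-- Under the weight `|resonator|²`, a Dirichlet polynomial supported on integers coprime to `Q`
has small mean square. -/
lemma integral_norm_sq_resonator_mul_rough_le {ε : ℂ} (hε : ‖ε‖ = 1) {Q y M : ℕ} (hQ : Q ≠ 0)
    (hy : 0 < y) {S : Finset ℕ} (hS : S ⊆ Finset.Ioc y M) (hcop : ∀ m ∈ S, Nat.Coprime m Q)
    (a : ℕ → ℂ) (ha : ∀ m ∈ S, ‖a m‖ ≤ 1 / m) {A B : ℝ} (hAB : A ≤ B) :
    ∫ t in A..B, ‖resonator ε Q t‖ ^ 2 *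
        ‖∑ m ∈ S, a m * cexp (-((Real.log m : ℝ) * I) * t)‖ ^ 2 ≤
      (B - A) * Q.divisors.card / y + 2 * (Q * M) * (Q.divisors.card * M) ^ 2 := by
  have hpos : ∀ m ∈ S, 0 < m := fun m hm => by have := Finset.mem_Ioc.1 (hS hm); omega
  have hMS := abs_integral_norm_sq_dirichletPoly_sub_le (Q.divisors ×ˢ S)
    (fun x => ε ^ ArithmeticFunction.cardFactors x.1 * a x.2) (fun x => x.1 * x.2) (by
      rintro ⟨r, m⟩ h1 ⟨r', m'⟩ h2 h
      simp only [Finset.coe_product, Set.mem_prod, Finset.mem_coe, Nat.mem_divisors] at h1 h2 h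
      have hg : ∀ r m : ℕ, r ∣ Q → m ∈ S → Nat.gcd (r * m) Q = r := fun r m hr hm => by
        rw [Nat.Coprime.gcd_mul_right_cancel r (hcop m hm)]
        exact Nat.gcd_eq_left hr
      have hr : r = r' := by
        rw [← hg r m h1.1.1 h1.2, h, hg r' m' h2.1.1 h2.2]
      subst hr
      have hr0 : 0 < r := Nat.pos_of_dvd_of_pos h1.1.1 (Nat.pos_of_ne_zero hQ)
      rw [Nat.eq_of_mul_eq_mul_left hr0 h]) ((Q : ℝ) * M) (by
      rintro ⟨r, m⟩ h1
      rw [Finset.mem_product] at h1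
      exact Nat.mul_pos (Nat.pos_of_mem_divisors h1.1) (hpos m h1.2)) (by
      rintro ⟨r, m⟩ h1
      rw [Finset.mem_product] at h1
      exact_mod_cast Nat.mul_le_mul (Nat.divisor_le h1.1) (Finset.mem_Ioc.1 (hS h1.2)).2) A B
  have hprod : ∀ t : ℝ, ‖resonator ε Q t‖ ^ 2 *
      ‖∑ m ∈ S, a m * cexp (-((Real.log m : ℝ) * I) * t)‖ ^ 2 =
      ‖∑ x ∈ Q.divisors ×ˢ S, ε ^ ArithmeticFunction.cardFactors x.1 * a x.2 *
        cexp (-((Real.log ((x.1 * x.2 : ℕ) : ℝ) : ℝ) * I) * t)‖ ^ 2 := by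
    intro t
    rw [← mul_pow, ← norm_mul, resonator, Finset.sum_mul_sum, Finset.sum_product]
    congr 2
    refine Finset.sum_congr rfl fun r hr => Finset.sum_congr rfl fun m hm => ?_
    have hr0 : (r : ℝ) ≠ 0 := by exact_mod_cast (Nat.pos_of_mem_divisors hr).ne'
    have hm0 : (m : ℝ) ≠ 0 := by exact_mod_cast (hpos m hm).ne'
    rw [twist, mul_mul_mul_comm, ← Complex.exp_add]
    congr 2
    push_cast
    rw [Real.log_mul hr0 hm0]
    push_cast
    ring
  simp_rw [hprod]
  have hdiag : ∑ x ∈ Q.divisors ×ˢ S, ‖ε ^ ArithmeticFunction.cardFactors x.1 * a x.2‖ ^ 2 ≤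
      Q.divisors.card / y := by
    rw [Finset.sum_product]
    simp only [norm_mul, norm_pow, hε, one_pow, one_mul, Finset.sum_const, nsmul_eq_mul]
    rw [div_eq_mul_one_div]
    gcongr
    refine le_trans ?_ (sum_Ioc_one_div_sq_le hy M)
    refine (Finset.sum_le_sum fun m hm => ?_).trans
      (Finset.sum_le_sum_of_subset_of_nonneg hS fun _ _ _ => by positivity)
    have := pow_le_pow_left₀ (norm_nonneg _) (ha m hm) 2
    rwa [div_pow, one_pow] at this
  have hone : ∑ x ∈ Q.divisors ×ˢ S, ‖ε ^ ArithmeticFunction.cardFactors x.1 * a x.2‖ ≤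
      Q.divisors.card * M := by
    rw [Finset.sum_product]
    simp only [norm_mul, norm_pow, hε, one_pow, one_mul, Finset.sum_const, nsmul_eq_mul]
    gcongr
    calc ∑ m ∈ S, ‖a m‖ ≤ ∑ m ∈ S, (1 : ℝ) := Finset.sum_le_sum fun m hm =>
          (ha m hm).trans (by
            have : (1 : ℝ) ≤ m := by exact_mod_cast hpos m hm
            rw [div_le_one (by linarith)]; exact this)
      _ = (S.card : ℝ) := by simp
      _ ≤ M := by
          have := Finset.card_le_card hS
          rw [Nat.card_Ioc] at this
          exact_mod_cast this.trans (Nat.sub_le _ _)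
  have h0 : 0 ≤ ∑ x ∈ Q.divisors ×ˢ S, ‖ε ^ ArithmeticFunction.cardFactors x.1 * a x.2‖ :=
    Finset.sum_nonneg fun _ _ => norm_nonneg _
  have h1 := (abs_le.1 hMS).2
  have h2 : (B - A) * ∑ x ∈ Q.divisors ×ˢ S, ‖ε ^ ArithmeticFunction.cardFactors x.1 * a x.2‖ ^ 2 ≤
      (B - A) * Q.divisors.card / y := by
    rw [mul_div_assoc]
    exact mul_le_mul_of_nonneg_left hdiag (by linarith)
  have h3 : 2 * ((Q : ℝ) * M) *
      (∑ x ∈ Q.divisors ×ˢ S, ‖ε ^ ArithmeticFunction.cardFactors x.1 * a x.2‖) ^ 2 ≤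
      2 * (Q * M) * (Q.divisors.card * M) ^ 2 := by gcongr
  linarith

open ArithmeticFunction in
lemma sum_moebius_divisors (n : ℕ) : ∑ d ∈ n.divisors, moebius d = if n = 1 then 1 else 0 := by
  rw [← coe_mul_zeta_apply, moebius_mul_coe_zeta, one_apply]

open ArithmeticFunction in
lemma exists_sieve_coeff (N : ℕ) {Q : ℕ} (hQ : Q ≠ 0) : ∃ c : ℕ → ℤ,
    (∀ m, |c m| ≤ Q) ∧ (∀ m, 0 < m → m ≤ N → c m = if Nat.Coprime m Q then 1 else 0) ∧
    ∀ f : ℕ → ℂ, f 1 = 1 → (∀ m n, m ≠ 0 → n ≠ 0 → f (m * n) = f m * f n) →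
      (∑ n ∈ Finset.Icc 1 N, f n) * ∏ p ∈ Q.primeFactors, (1 - f p) =
        ∑ m ∈ Finset.Icc 1 (N * Q), c m * f m := by
  set P := ∏ p ∈ Q.primeFactors, p with hP
  have hPQ : P ∣ Q := Nat.prod_primeFactors_dvd Q
  have hP0 : P ≠ 0 := fun h => hQ (by rw [h] at hPQ; exact zero_dvd_iff.1 hPQ)
  have hPle : P ≤ Q := Nat.le_of_dvd (Nat.pos_of_ne_zero hQ) hPQ
  have hPpf : P.primeFactors = Q.primeFactors := Nat.primeFactors_prod_primeFactors Q
  have hPsq : Squarefree P := by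
    refine Finset.squarefree_prod_of_pairwise_isCoprime (fun p hp q hq hpq => ?_) fun p hp =>
      (Nat.prime_of_mem_primeFactors hp).squarefree
    refine Nat.coprime_iff_isRelPrime.1 ?_
    exact (Nat.coprime_primes (Nat.prime_of_mem_primeFactors hp)
      (Nat.prime_of_mem_primeFactors hq)).2 hpq
  have hcopP : ∀ m, Nat.Coprime m P ↔ Nat.Coprime m Q := fun m => by
    refine ⟨fun h => ?_, fun h => h.coprime_dvd_right hPQ⟩
    rw [Nat.coprime_iff_gcd_eq_one] at *
    by_contra hne
    obtain ⟨q, hq, hqd⟩ := Nat.exists_prime_and_dvd hne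
    have hqP : q ∣ P := Nat.dvd_of_mem_primeFactors (by
      rw [hPpf]; exact Nat.mem_primeFactors.2 ⟨hq, hqd.trans (Nat.gcd_dvd_right _ _), hQ⟩)
    have := Nat.dvd_gcd (hqd.trans (Nat.gcd_dvd_left _ _)) hqP
    rw [h] at this
    exact hq.one_lt.ne' (Nat.dvd_one.1 this)
  refine ⟨fun m => ∑ x ∈ (P.divisors ×ˢ Finset.Icc 1 N).filter (fun x => x.1 * x.2 = m),
    moebius x.1, fun m => ?_, fun m hm hmN => ?_, fun f hf1 hf => ?_⟩
  · refine (Finset.abs_sum_le_sum_abs _ _).trans ?_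
    refine (Finset.sum_le_sum fun x _ => abs_moebius_le_one).trans ?_
    rw [Finset.sum_const, nsmul_eq_mul, mul_one]
    have hinj : Set.InjOn Prod.fst
        (((P.divisors ×ˢ Finset.Icc 1 N).filter (fun x => x.1 * x.2 = m) : Finset (ℕ × ℕ)) :
          Set (ℕ × ℕ)) := by
      rintro ⟨d, n⟩ h1 ⟨d', n'⟩ h2 h
      simp only [Finset.coe_filter, Finset.mem_product, Set.mem_ofPred_eq] at h1 h2 h
      subst h
      rw [Nat.eq_of_mul_eq_mul_left (Nat.pos_of_mem_divisors h1.1.1) (h1.2.trans h2.2.symm)]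
    have hcard := Finset.card_le_card_of_injOn (t := P.divisors) Prod.fst (fun x hx => by
      simp only [Finset.coe_filter, Finset.mem_product, Set.mem_ofPred_eq] at hx
      exact hx.1.1) hinj
    exact_mod_cast hcard.trans ((Nat.card_divisors_le_self P).trans hPle)
  · have h1 : ∑ x ∈ (P.divisors ×ˢ Finset.Icc 1 N).filter (fun x => x.1 * x.2 = m), moebius x.1 =
        ∑ d ∈ (Nat.gcd m P).divisors, moebius d := by
      refine Finset.sum_bij' (fun x _ => x.1) (fun d _ => (d, m / d)) ?_ ?_ ?_ ?_ ?_
      · rintro ⟨d, n⟩ h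
        simp only [Finset.mem_filter, Finset.mem_product, Nat.mem_divisors] at h ⊢
        exact ⟨Nat.dvd_gcd ⟨n, h.2.symm⟩ h.1.1.1, (Nat.gcd_pos_of_pos_left _ hm).ne'⟩
      · intro d h
        simp only [Finset.mem_filter, Finset.mem_product, Nat.mem_divisors, Finset.mem_Icc] at h ⊢
        have hdm := h.1.trans (Nat.gcd_dvd_left _ _)
        have hd0 := Nat.pos_of_dvd_of_pos hdm hm
        exact ⟨⟨⟨h.1.trans (Nat.gcd_dvd_right _ _), hP0⟩,
          Nat.div_pos (Nat.le_of_dvd hm hdm) hd0, (Nat.div_le_self _ _).trans hmN⟩,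
          Nat.mul_div_cancel' hdm⟩
      · rintro ⟨d, n⟩ h
        simp only [Finset.mem_filter, Finset.mem_product] at h
        simp only [Prod.mk.injEq, true_and]
        rw [← h.2, Nat.mul_div_cancel_left _ (Nat.pos_of_mem_divisors h.1.1)]
      · intro d _; rfl
      · intro x _; rfl
    simp only
    rw [h1, sum_moebius_divisors]
    simp only [hcopP]
  · let g : ArithmeticFunction ℂ := ⟨fun n => if n = 0 then 0 else f n, by simp⟩
    have hgf : ∀ n, n ≠ 0 → g n = f n := fun n hn => by simp [g, hn]
    have hg : g.IsMultiplicative := by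
      rw [IsMultiplicative.iff_ne_zero]
      refine ⟨by rw [hgf 1 one_ne_zero, hf1], fun {m n} hm hn _ => ?_⟩
      rw [hgf _ (mul_ne_zero hm hn), hgf m hm, hgf n hn, hf m n hm hn]
    have hF : ∏ p ∈ Q.primeFactors, (1 - f p) = ∑ d ∈ P.divisors, moebius d * f d := by
      have := IsMultiplicative.prodPrimeFactors_one_sub_of_squarefree g hg hPsq
      rw [hPpf] at this
      calc _ = ∏ p ∈ Q.primeFactors, (1 - g p) := Finset.prod_congr rfl fun p hp => by
              rw [hgf p (Nat.prime_of_mem_primeFactors hp).ne_zero]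
        _ = _ := this
        _ = _ := Finset.sum_congr rfl fun d hd => by
              rw [hgf d (Nat.pos_of_mem_divisors hd).ne']
    rw [hF, mul_comm, Finset.sum_mul_sum, ← Finset.sum_product']
    rw [← Finset.sum_fiberwise_of_maps_to (s := P.divisors ×ˢ Finset.Icc 1 N)
      (t := Finset.Icc 1 (N * Q)) (g := fun x => x.1 * x.2) (by
        rintro ⟨d, n⟩ h
        simp only [Finset.mem_product, Finset.mem_Icc] at h ⊢
        refine ⟨Nat.mul_pos (Nat.pos_of_mem_divisors h.1) h.2.1, ?_⟩
        rw [mul_comm N]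
        exact Nat.mul_le_mul ((Nat.divisor_le h.1).trans hPle) h.2.2)]
    refine Finset.sum_congr rfl fun m _ => ?_
    push_cast
    rw [Finset.sum_mul]
    refine Finset.sum_congr rfl fun x hx => ?_
    simp only [Finset.mem_filter, Finset.mem_product, Finset.mem_Icc] at hx
    have h2 : x.2 ≠ 0 := by omega
    rw [← hx.2, hf x.1 x.2 (Nat.pos_of_mem_divisors hx.1.1).ne' h2, mul_assoc]

open Complex in
/-- The relative error on the line `Re s = 1` in replacing `ζ` by its Euler product over the primes
dividing `Q`. -/
noncomputable def eulerError (Q : ℕ) (t : ℝ) : ℂ :=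
  riemannZeta (1 + I * t) * ∏ p ∈ Q.primeFactors, (1 - (p : ℂ) ^ (-(1 + I * t))) - 1

open Complex in
lemma continuousAt_riemannZeta_one_add {t : ℝ} (ht : t ≠ 0) :
    ContinuousAt (fun t : ℝ => riemannZeta (1 + I * t)) t := by
  refine ContinuousAt.comp (g := riemannZeta) (differentiableAt_riemannZeta ?_).continuousAt
    (by fun_prop)
  simp [ht]

open Complex in
lemma continuousOn_eulerError (Q : ℕ) : ContinuousOn (eulerError Q) (Set.Ioi 0) := by
  intro t ht
  refine ContinuousAt.continuousWithinAt ?_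
  unfold eulerError
  refine ((continuousAt_riemannZeta_one_add (ne_of_gt ht)).mul (Continuous.continuousAt ?_)).sub
    continuousAt_const
  refine continuous_finsetProd _ fun p hp => continuous_const.sub ?_
  have : (p : ℂ) ≠ 0 := by exact_mod_cast (Nat.prime_of_mem_primeFactors hp).ne_zero
  exact Continuous.const_cpow (by fun_prop) (Or.inl this)

open Complex in
lemma natCast_cpow_neg_one_add {n : ℕ} (hn : 0 < n) (T u : ℝ) :
    (n : ℂ) ^ (-(1 + I * ((T + u : ℝ) : ℂ))) =
      (n : ℂ) ^ (-(1 + I * u)) * cexp (-((Real.log n : ℝ) * I) * T) := by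
  have hn' : (n : ℂ) ≠ 0 := by exact_mod_cast hn.ne'
  rw [cpow_def_of_ne_zero hn', cpow_def_of_ne_zero hn', ← Complex.exp_add, Complex.natCast_log]
  congr 1
  push_cast
  ring

open Complex in
lemma norm_natCast_cpow_neg_one_add {n : ℕ} (hn : 0 < n) (u : ℝ) :
    ‖(n : ℂ) ^ (-(1 + I * u))‖ = 1 / n := by
  rw [norm_natCast_cpow_neg hn]
  simp [Real.rpow_neg_one]

open Complex in
lemma norm_prod_primeFactors_one_sub_le {Q : ℕ} (hQ : Q ≠ 0) (t : ℝ) :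
    ‖∏ p ∈ Q.primeFactors, (1 - (p : ℂ) ^ (-(1 + I * t)))‖ ≤ Q := by
  rw [norm_prod]
  calc _ ≤ ∏ p ∈ Q.primeFactors, (p : ℝ) := by
        refine Finset.prod_le_prod (fun _ _ => norm_nonneg _) fun p hp => ?_
        have hp' := Nat.prime_of_mem_primeFactors hp
        have h2 : (2 : ℝ) ≤ p := by exact_mod_cast hp'.two_le
        refine (norm_sub_le _ _).trans ?_
        rw [norm_one, norm_natCast_cpow_neg_one_add hp'.pos]
        have : (1 : ℝ) / p ≤ 1 := by rw [div_le_one (by linarith)]; linarith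
        linarith
    _ ≤ Q := by
        rw [← Nat.cast_prod]
        exact_mod_cast Nat.le_of_dvd (Nat.pos_of_ne_zero hQ) (Nat.prod_primeFactors_dvd Q)

open Complex in
/-- The error is a Dirichlet polynomial over integers in `(1, M]` coprime to `Q`, plus a Dirichlet
polynomial supported above `M`, plus a small remainder. -/
lemma eulerError_approx {Q M N : ℕ} (hQ : Q ≠ 0) (hM : 0 < M) (hMN : M ≤ N) : ∃ c : ℕ → ℤ,
    (∀ m, |c m| ≤ Q) ∧ ∀ T u : ℝ, T + u ≠ 0 →
    ‖eulerError Q (T + u) - ((∑ m ∈ (Finset.Ioc 1 M).filter (fun m => Nat.Coprime m Q),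
          (m : ℂ) ^ (-(1 + I * u)) * cexp (-((Real.log m : ℝ) * I) * T)) +
        ∑ m ∈ Finset.Ioc M (N * Q),
          (c m * (m : ℂ) ^ (-(1 + I * u))) * cexp (-((Real.log m : ℝ) * I) * T))‖ ≤
      (2 / |T + u| + 4 * (1 + |T + u|) / N) * Q := by
  obtain ⟨c, hc, hcN, hf⟩ := exists_sieve_coeff N hQ
  refine ⟨c, hc, fun T u hTu => ?_⟩
  have hQ1 : 1 ≤ Q := Nat.one_le_iff_ne_zero.2 hQ
  have hsum := hf (fun n => (n : ℂ) ^ (-(1 + I * ((T + u : ℝ) : ℂ)))) (by simp) (fun m n _ _ => by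
    simp only [Nat.cast_mul]
    exact natCast_mul_natCast_cpow m n _)
  have hMNQ : M ≤ N * Q := hMN.trans (Nat.le_mul_of_pos_right N (by omega))
  have hsplit : Finset.Icc 1 (N * Q) = insert 1 (Finset.Ioc 1 M ∪ Finset.Ioc M (N * Q)) := by
    ext n
    simp only [Finset.mem_Icc, Finset.mem_insert, Finset.mem_union, Finset.mem_Ioc]
    omega
  have hd : Disjoint (Finset.Ioc 1 M) (Finset.Ioc M (N * Q)) := by
    rw [Finset.disjoint_left]; intro n; simp only [Finset.mem_Ioc]; omega
  have hn1 : 1 ∉ Finset.Ioc 1 M ∪ Finset.Ioc M (N * Q) := by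
    simp only [Finset.mem_union, Finset.mem_Ioc]; omega
  have hterm : ∀ n : ℕ, 0 < n → (n : ℂ) ^ (-(1 + I * ((T + u : ℝ) : ℂ))) =
      (n : ℂ) ^ (-(1 + I * u)) * cexp (-((Real.log n : ℝ) * I) * T) :=
    fun n hn => natCast_cpow_neg_one_add hn T u
  have hc1 : c 1 = 1 := by rw [hcN 1 one_pos (by omega)]; simp
  rw [hsplit, Finset.sum_insert hn1, Finset.sum_union hd] at hsum
  have h1 : ∑ m ∈ Finset.Ioc 1 M, (c m : ℂ) * (m : ℂ) ^ (-(1 + I * ((T + u : ℝ) : ℂ))) =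
      ∑ m ∈ (Finset.Ioc 1 M).filter (fun m => Nat.Coprime m Q),
          (m : ℂ) ^ (-(1 + I * u)) * cexp (-((Real.log m : ℝ) * I) * T) := by
    rw [Finset.sum_filter]
    refine Finset.sum_congr rfl fun m hm => ?_
    rw [Finset.mem_Ioc] at hm
    rw [hcN m (by omega) (by omega), hterm m (by omega)]
    split_ifs <;> simp
  have h2 : ∑ m ∈ Finset.Ioc M (N * Q), (c m : ℂ) * (m : ℂ) ^ (-(1 + I * ((T + u : ℝ) : ℂ))) =
      ∑ m ∈ Finset.Ioc M (N * Q),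
          (c m * (m : ℂ) ^ (-(1 + I * u))) * cexp (-((Real.log m : ℝ) * I) * T) := by
    refine Finset.sum_congr rfl fun m hm => ?_
    rw [Finset.mem_Ioc] at hm
    rw [hterm m (by omega), mul_assoc]
  rw [h1, h2, hc1] at hsum
  simp only [Int.cast_one, Nat.cast_one, one_cpow, mul_one] at hsum
  rw [← add_sub_cancel_left (1 : ℂ) (_ + _), ← hsum]
  unfold eulerError
  rw [sub_sub_sub_cancel_right, ← sub_mul, norm_mul]
  exact mul_le_mul (norm_riemannZeta_sub_sum_le hTu (by omega))
    (norm_prod_primeFactors_one_sub_le hQ _) (norm_nonneg _) (by positivity)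

lemma resonance_error_terms_le {q D X L : ℝ} (hq : 2 ≤ q) (hD : 0 ≤ D) (hDq : D ≤ q)
    (hX : X = q ^ 30) (hL : 0 ≤ L) (hLq : L ≤ 61 * q) :
    2 * (q * q ^ 6) * (D * q ^ 6) ^ 2 ≤ q ^ 29 ∧ D ^ 2 * (q ^ 2 * (X / q ^ 6)) ≤ q ^ 29 ∧
      D ^ 2 * (q ^ 2 * (8 * L ^ 2)) ≤ q ^ 29 ∧ X * (D ^ 2 * (18 / X * q) ^ 2) ≤ q ^ 29 := by
  have hq0 : 0 < q := by linarith
  have hX1 : 1 ≤ X := hX ▸ one_le_pow₀ (by linarith)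
  have hpow : ∀ k : ℕ, k ≤ 29 → q ^ k ≤ q ^ 29 := fun k hk =>
    pow_le_pow_right₀ (by linarith) hk
  refine ⟨?_, ?_, ?_, ?_⟩
  · calc 2 * (q * q ^ 6) * (D * q ^ 6) ^ 2 ≤ q * (q * q ^ 6) * (q * q ^ 6) ^ 2 := by gcongr
      _ = q ^ 22 := by ring
      _ ≤ q ^ 29 := hpow 22 (by norm_num)
  · have : X / q ^ 6 = q ^ 24 := by
      rw [hX, div_eq_iff (by positivity)]; ring
    rw [this]
    calc D ^ 2 * (q ^ 2 * q ^ 24) ≤ q ^ 2 * (q ^ 2 * q ^ 24) := by gcongr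
      _ = q ^ 28 := by ring
      _ ≤ q ^ 29 := hpow 28 (by norm_num)
  · calc D ^ 2 * (q ^ 2 * (8 * L ^ 2)) ≤ q ^ 2 * (q ^ 2 * (8 * (61 * q) ^ 2)) := by gcongr
      _ = 29768 * q ^ 6 := by ring
      _ ≤ 2 ^ 15 * q ^ 6 := by gcongr; norm_num
      _ ≤ q ^ 15 * q ^ 6 := by gcongr
      _ = q ^ 21 := by ring
      _ ≤ q ^ 29 := hpow 21 (by norm_num)
  · have : X * (D ^ 2 * (18 / X * q) ^ 2) = 324 * D ^ 2 * q ^ 2 / X := by field_simp; ring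
    rw [this]
    calc 324 * D ^ 2 * q ^ 2 / X ≤ 324 * D ^ 2 * q ^ 2 := div_le_self (by positivity) hX1
      _ ≤ 2 ^ 9 * q ^ 2 * q ^ 2 := by gcongr; norm_num
      _ ≤ q ^ 9 * q ^ 2 * q ^ 2 := by gcongr
      _ = q ^ 13 := by ring
      _ ≤ q ^ 29 := hpow 13 (by norm_num)

open Complex in
/-- Under the weight `|resonator|²` the error is small in mean square. -/
lemma integral_norm_sq_resonator_mul_eulerError_le {ε : ℂ} (hε : ‖ε‖ = 1) {Q y : ℕ} (hQ : 2 ≤ Q)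
    (hy : 0 < y) (hyQ : y ≤ Q) (hcop : ∀ m, 1 < m → Nat.Coprime m Q → y < m) {u : ℝ} (hu0 : 0 ≤ u)
    (hu1 : u ≤ 1) :
    ∫ t in (Q : ℝ) ^ 30..2 * (Q : ℝ) ^ 30, ‖resonator ε Q t‖ ^ 2 * ‖eulerError Q (t + u)‖ ^ 2 ≤
      15 * ((Q : ℝ) ^ 30 * Q.divisors.card / y) := by
  have hQ0 : Q ≠ 0 := by omega
  have hMN : Q ^ 6 ≤ Q ^ 60 := Nat.pow_le_pow_right (by omega) (by norm_num)
  obtain ⟨c, hc, happ⟩ := eulerError_approx (N := Q ^ 60) hQ0 (pow_pos (by omega : 0 < Q) 6) hMN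
  set q : ℝ := (Q : ℝ) with hq
  set X : ℝ := q ^ 30 with hX
  set D : ℝ := (Q.divisors.card : ℝ) with hD
  have hq2 : (2 : ℝ) ≤ q := by rw [hq]; exact_mod_cast hQ
  have hq1 : (1 : ℝ) ≤ q := by linarith
  have hX1 : 1 ≤ X := one_le_pow₀ hq1
  have hDq : D ≤ q := by rw [hD, hq]; exact_mod_cast Nat.card_divisors_le_self Q
  have hD1 : 1 ≤ D := by
    rw [hD]; exact_mod_cast Finset.card_pos.2 ⟨1, by simp [hQ0]⟩
  have hy0 : (0 : ℝ) < y := by exact_mod_cast hy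
  have hyq : (y : ℝ) ≤ q := by rw [hq]; exact_mod_cast hyQ
  have hAB : X ≤ 2 * X := by linarith
  set S := (Finset.Ioc 1 (Q ^ 6)).filter (fun m => Nat.Coprime m Q) with hS
  set a : ℕ → ℂ := fun m => (m : ℂ) ^ (-(1 + I * u)) with ha
  set b : ℕ → ℂ := fun m => c m * (m : ℂ) ^ (-(1 + I * u)) with hb
  set A : ℝ → ℂ := fun t => ∑ m ∈ S, a m * cexp (-((Real.log m : ℝ) * I) * t) with hA
  set B : ℝ → ℂ := fun t => ∑ m ∈ Finset.Ioc (Q ^ 6) (Q ^ 60 * Q),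
    b m * cexp (-((Real.log m : ℝ) * I) * t) with hB
  have hAc : Continuous A := continuous_finsetSum _ fun m _ => by fun_prop
  have hBc : Continuous B := continuous_finsetSum _ fun m _ => by fun_prop
  have hI1 := integral_norm_sq_resonator_mul_rough_le hε hQ0 hy (S := S) (M := Q ^ 6) (by
    intro m hm
    rw [hS, Finset.mem_filter, Finset.mem_Ioc] at hm
    rw [Finset.mem_Ioc]
    exact ⟨hcop m hm.1.1 hm.2, hm.1.2⟩) (fun m hm => by
      rw [hS, Finset.mem_filter] at hm; exact hm.2) a (fun m hm => by
      rw [hS, Finset.mem_filter, Finset.mem_Ioc] at hm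
      exact (norm_natCast_cpow_neg_one_add (by omega) u).le) hAB
  have hI2 := integral_norm_sq_dirichletTail_le (S := Finset.Ioc (Q ^ 6) (Q ^ 60 * Q))
    (pow_pos (by omega : 0 < Q) 6) (Finset.Subset.refl _) b (K := q) (fun m hm => by
      rw [Finset.mem_Ioc] at hm
      rw [hb]
      simp only
      rw [norm_mul, norm_natCast_cpow_neg_one_add (by omega), mul_one_div]
      gcongr
      rw [Complex.norm_intCast]
      rw [hq]
      exact_mod_cast hc m) hAB
  have hpt : ∀ t ∈ Set.Icc X (2 * X), ‖resonator ε Q t‖ ^ 2 * ‖eulerError Q (t + u)‖ ^ 2 ≤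
      3 * (‖resonator ε Q t‖ ^ 2 * ‖A t‖ ^ 2) + (3 * D ^ 2) * ‖B t‖ ^ 2 +
        3 * (D ^ 2 * (18 / X * q) ^ 2) := by
    intro t ht
    have htu : X ≤ t + u := by linarith [ht.1]
    have htu' : 0 < t + u := by linarith
    have h1 := happ t u htu'.ne'
    have h2 : (2 / |t + u| + 4 * (1 + |t + u|) / (Q ^ 60 : ℕ)) * q ≤ 18 / X * q := by
      gcongr
      rw [abs_of_pos htu']
      have h3 : ((Q ^ 60 : ℕ) : ℝ) = X ^ 2 := by rw [hX, ← pow_mul]; push_cast; rfl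
      rw [h3]
      calc 2 / (t + u) + 4 * (1 + (t + u)) / X ^ 2 ≤ 2 / X + 4 * (4 * X) / X ^ 2 := by
            gcongr
            linarith [ht.2]
        _ = 18 / X := by field_simp; ring
    have h3 := h1.trans h2
    set E := eulerError Q (t + u) - (A t + B t) with hE
    have h4 : eulerError Q (t + u) = A t + B t + E := by rw [hE]; ring
    have h5 : ‖eulerError Q (t + u)‖ ≤ ‖A t‖ + ‖B t‖ + 18 / X * q := by
      rw [h4]
      exact (norm_add_le _ _).trans (add_le_add (norm_add_le _ _) h3)
    have h6 : ‖eulerError Q (t + u)‖ ^ 2 ≤ 3 * (‖A t‖ ^ 2 + ‖B t‖ ^ 2 + (18 / X * q) ^ 2) := by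
      refine (pow_le_pow_left₀ (norm_nonneg _) h5 2).trans ?_
      nlinarith [sq_nonneg (‖A t‖ - ‖B t‖), sq_nonneg (‖A t‖ - 18 / X * q),
        sq_nonneg (‖B t‖ - 18 / X * q)]
    have h7 : ‖resonator ε Q t‖ ^ 2 ≤ D ^ 2 :=
      pow_le_pow_left₀ (norm_nonneg _) (norm_resonator_le hε Q t) 2
    have h8 := mul_le_mul_of_nonneg_left h6 (sq_nonneg ‖resonator ε Q t‖)
    have h9 := mul_le_mul_of_nonneg_right h7 (sq_nonneg ‖B t‖)
    have h10 := mul_le_mul_of_nonneg_right h7 (sq_nonneg (18 / X * q))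
    linarith
  have hint : ContinuousOn (fun t => ‖resonator ε Q t‖ ^ 2 * ‖eulerError Q (t + u)‖ ^ 2)
      (Set.uIcc X (2 * X)) := by
    refine ((continuous_resonator ε Q).norm.pow 2).continuousOn.mul (ContinuousOn.pow
      (ContinuousOn.norm ((continuousOn_eulerError Q).comp (by fun_prop) ?_)) 2)
    intro t ht
    rw [Set.uIcc_of_le hAB] at ht
    simp only [Set.mem_Ioi]
    linarith [ht.1]
  have hRA : IntervalIntegrable (fun t => 3 * (‖resonator ε Q t‖ ^ 2 * ‖A t‖ ^ 2))
      MeasureTheory.volume X (2 * X) :=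
    (continuous_const.mul (((continuous_resonator ε Q).norm.pow 2).mul
      (hAc.norm.pow 2))).intervalIntegrable _ _
  have hRB : IntervalIntegrable (fun t => (3 * D ^ 2) * ‖B t‖ ^ 2)
      MeasureTheory.volume X (2 * X) :=
    (continuous_const.mul (hBc.norm.pow 2)).intervalIntegrable _ _
  have hRC : IntervalIntegrable (fun _ : ℝ => 3 * (D ^ 2 * (18 / X * q) ^ 2))
      MeasureTheory.volume X (2 * X) := continuous_const.intervalIntegrable _ _
  have hmono := intervalIntegral.integral_mono_on hAB hint.intervalIntegrable
    ((hRA.add hRB).add hRC) hpt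
  rw [intervalIntegral.integral_add (hRA.add hRB) hRC, intervalIntegral.integral_add hRA hRB,
    intervalIntegral.integral_const_mul, intervalIntegral.integral_const_mul,
    intervalIntegral.integral_const, smul_eq_mul] at hmono
  refine hmono.trans ?_
  have hXX : 2 * X - X = X := by ring
  rw [hXX] at hI1 hI2 ⊢
  have hbase : q ^ 29 ≤ X * D / y := by
    rw [le_div_iff₀ hy0]
    calc q ^ 29 * y ≤ q ^ 29 * q := by gcongr
      _ = X * 1 := by rw [hX]; ring
      _ ≤ X * D := by gcongr
  have hlog : 1 + Real.log ((Q ^ 60 * Q : ℕ) : ℝ) ≤ 61 * q := by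
    rw [← pow_succ, Nat.cast_pow, Real.log_pow, ← hq]
    have := Real.log_le_sub_one_of_pos (show 0 < q by linarith)
    push_cast
    linarith
  have hlog0 : 0 ≤ 1 + Real.log ((Q ^ 60 * Q : ℕ) : ℝ) := by
    have := Real.log_natCast_nonneg (Q ^ 60 * Q)
    linarith
  have hQ6 : ((Q ^ 6 : ℕ) : ℝ) = q ^ 6 := by rw [hq, Nat.cast_pow]
  obtain ⟨e1, e2, e3, e4⟩ := resonance_error_terms_le hq2 (by linarith) hDq hX hlog0 hlog
  rw [← hQ6] at e1 e2
  have hI2' := mul_le_mul_of_nonneg_left hI2 (sq_nonneg D)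
  rw [mul_add, mul_add] at hI2'
  linarith

open MeasureTheory in
/-- There are `T ∈ [Q ^ 30, 2 Q ^ 30]` where the error is small on average over `[T, T + 1]` and
simultaneously all `ε p ^ (-iT)` with `p ∣ Q` are close to `1`. -/
lemma exists_resonant_point {ε : ℂ} (hε : ‖ε‖ = 1) {Q y k : ℕ} (hQ : 2 ≤ Q)
    (hy : 0 < y) (hyQ : y ≤ Q) (hcop : ∀ m, 1 < m → Nat.Coprime m Q → y < m)
    (hk : ∀ p ∈ Q.primeFactors, p ^ k ∣ Q) (hkQ : k + 1 ≤ Q) (hcard : Q.primeFactors.card ≤ y) :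
    ∃ T : ℝ, (Q : ℝ) ^ 30 ≤ T ∧ T ≤ 2 * (Q : ℝ) ^ 30 ∧
      ∫ u in (0 : ℝ)..1, ‖eulerError Q (T + u)‖ ^ 2 ≤ 75 / y ∧
      ∑ p ∈ Q.primeFactors, ‖1 - twist ε T p‖ ^ 2 ≤ 40 * y / (k + 1) := by
  have hQ0 : Q ≠ 0 := by omega
  set q : ℝ := (Q : ℝ) with hq
  set X : ℝ := q ^ 30 with hX
  set D : ℝ := (Q.divisors.card : ℝ) with hD
  have hq2 : (2 : ℝ) ≤ q := by rw [hq]; exact_mod_cast hQ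
  have hX1 : 1 ≤ X := one_le_pow₀ (by linarith)
  have hDq : D ≤ q := by rw [hD, hq]; exact_mod_cast Nat.card_divisors_le_self Q
  have hD1 : 1 ≤ D := by
    rw [hD]; exact_mod_cast Finset.card_pos.2 ⟨1, by simp [hQ0]⟩
  have hy0 : (0 : ℝ) < y := by exact_mod_cast hy
  have hkq : (k : ℝ) + 1 ≤ q := by rw [hq]; exact_mod_cast hkQ
  have hAB : X ≤ 2 * X := by linarith
  have hXX : 2 * X - X = X := by ring
  have hoff : 2 * q * D ^ 2 ≤ X * D / (k + 1) := by
    rw [le_div_iff₀ (by positivity)]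
    calc 2 * q * D ^ 2 * (k + 1) = (2 * q * D * (k + 1)) * D := by ring
      _ ≤ (q * q * q * q) * D := by gcongr
      _ = q ^ 4 * D := by ring
      _ ≤ X * D := by
          gcongr
          exact pow_le_pow_right₀ (by linarith) (by norm_num)
  set W : ℝ → ℝ := fun t => ‖resonator ε Q t‖ ^ 2 with hW
  have hWc : Continuous W := (continuous_resonator ε Q).norm.pow 2
  have hW0 : ∀ t, 0 ≤ W t := fun t => sq_nonneg _
  set G : ℝ → ℝ := fun t => ∫ u in (0 : ℝ)..1, ‖eulerError Q (t + u)‖ ^ 2 with hG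
  set H : ℝ → ℝ := fun t => ∑ p ∈ Q.primeFactors, ‖1 - twist ε t p‖ ^ 2 with hH
  have hG0 : ∀ t, 0 ≤ G t := fun t =>
    intervalIntegral.integral_nonneg zero_le_one fun _ _ => sq_nonneg _
  have hH0 : ∀ t, 0 ≤ H t := fun t => Finset.sum_nonneg fun _ _ => sq_nonneg _
  have hHc : Continuous H := continuous_finsetSum _ fun p _ =>
    (continuous_const.sub (continuous_twist ε p)).norm.pow 2
  have hmass : X * D / 2 ≤ ∫ t in X..2 * X, W t := by
    have h := (abs_le.1 (abs_integral_norm_sq_resonator_sub_le hε Q X (2 * X))).1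
    rw [hXX] at h
    have h2 : 2 * q * D ^ 2 ≤ X * D / 2 := by
      calc 2 * q * D ^ 2 = (2 * q * D) * D := by ring
        _ ≤ (q * q * q) * D := by gcongr
        _ = q ^ 3 * 1 * D := by ring
        _ ≤ q ^ 3 * (q ^ 27 / 2) * D := by
            gcongr
            have : q ^ 1 ≤ q ^ 27 := pow_le_pow_right₀ (by linarith) (by norm_num)
            linarith
        _ = X * D / 2 := by rw [hX]; ring
    linarith
  have hprime : ∫ t in X..2 * X, W t * H t ≤ 8 * y * (X * D / (k + 1)) := by
    have h1 : ∀ t, W t * H t = ∑ p ∈ Q.primeFactors, W t * ‖1 - twist ε t p‖ ^ 2 := fun t => by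
      rw [hH, Finset.mul_sum]
    simp_rw [h1]
    have hci : ∀ p ∈ Q.primeFactors, IntervalIntegrable
        (fun t => W t * ‖1 - twist ε t p‖ ^ 2) volume X (2 * X) := fun p _ =>
      (hWc.mul ((continuous_const.sub (continuous_twist ε p)).norm.pow 2)).intervalIntegrable _ _
    rw [intervalIntegral.integral_finsetSum hci]
    have h2 : ∀ p ∈ Q.primeFactors, ∫ t in X..2 * X, W t * ‖1 - twist ε t p‖ ^ 2 ≤
        8 * (X * D / (k + 1)) := fun p hp => by
      have h := integral_norm_sq_resonator_mul_one_sub_twist_le hε hQ0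
        (Nat.prime_of_mem_primeFactors hp) (hk p hp) hAB
      rw [hXX] at h
      linarith
    refine (Finset.sum_le_sum h2).trans ?_
    rw [Finset.sum_const, nsmul_eq_mul]
    calc _ ≤ (y : ℝ) * (8 * (X * D / (k + 1))) := by gcongr
      _ = _ := by ring
  have hFint : IntegrableOn (Function.uncurry fun t u : ℝ => W t * ‖eulerError Q (t + u)‖ ^ 2)
      (Set.uIoc X (2 * X) ×ˢ Set.uIoc (0 : ℝ) 1) := by
    rw [Set.uIoc_of_le hAB, Set.uIoc_of_le zero_le_one]
    refine IntegrableOn.mono_set (t := Set.Icc X (2 * X) ×ˢ Set.Icc (0 : ℝ) 1) ?_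
      (Set.prod_mono Set.Ioc_subset_Icc_self Set.Ioc_subset_Icc_self)
    refine ContinuousOn.integrableOn_compact (isCompact_Icc.prod isCompact_Icc) ?_
    refine (hWc.comp continuous_fst).continuousOn.mul (ContinuousOn.pow (ContinuousOn.norm
      ((continuousOn_eulerError Q).comp (by fun_prop) ?_)) 2)
    rintro ⟨t, u⟩ ⟨ht, hu⟩
    simp only [Set.mem_Ioi]
    simp only at ht hu
    linarith [ht.1, hu.1]
  have hWG : ∀ t, W t * G t = ∫ u in (0 : ℝ)..1, W t * ‖eulerError Q (t + u)‖ ^ 2 := fun t => by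
    rw [hG, intervalIntegral.integral_const_mul]
  have hWGint : IntervalIntegrable (fun t => W t * G t) volume X (2 * X) := by
    simp_rw [hWG, intervalIntegral.integral_of_le (zero_le_one (α := ℝ))]
    rw [intervalIntegrable_iff]
    rw [IntegrableOn, Measure.volume_eq_prod, ← Measure.prod_restrict,
      Set.uIoc_of_le (zero_le_one (α := ℝ))] at hFint
    exact hFint.integral_prod_left
  have herr : ∫ t in X..2 * X, W t * G t ≤ 15 * (X * D / y) := by
    simp_rw [hWG]
    rw [intervalIntegral_intervalIntegral_swap hFint]
    have hb : ∀ u ∈ Set.uIoc (0 : ℝ) 1,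
        ‖∫ t in X..2 * X, W t * ‖eulerError Q (t + u)‖ ^ 2‖ ≤ 15 * (X * D / y) := fun u hu => by
      rw [Set.uIoc_of_le zero_le_one] at hu
      rw [Real.norm_eq_abs, abs_of_nonneg (intervalIntegral.integral_nonneg hAB fun t _ =>
        mul_nonneg (hW0 t) (sq_nonneg _))]
      exact integral_norm_sq_resonator_mul_eulerError_le hε hQ hy hyQ hcop hu.1.le hu.2
    have h := intervalIntegral.norm_integral_le_of_norm_le_const hb
    rw [sub_zero, abs_one, mul_one] at h
    exact (le_abs_self _).trans h
  have hWHint : IntervalIntegrable (fun t => W t * H t) volume X (2 * X) :=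
    (hWc.mul hHc).intervalIntegrable _ _
  obtain ⟨T, hT, hΦ⟩ : ∃ T ∈ Set.Icc X (2 * X),
      y / 15 * G T + (k + 1) / (8 * y) * H T ≤ 5 := by
    by_contra! hcon
    have h1 : ∫ t in X..2 * X, 5 * W t ≤ ∫ t in X..2 * X,
        (y / 15 * (W t * G t) + (k + 1) / (8 * y) * (W t * H t)) := by
      refine intervalIntegral.integral_mono_on hAB
        (Continuous.intervalIntegrable (continuous_const.mul hWc) _ _)
        ((hWGint.const_mul _).add (hWHint.const_mul _)) fun t ht => ?_
      have := mul_le_mul_of_nonneg_left (hcon t ht).le (hW0 t)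
      linarith
    rw [intervalIntegral.integral_add (hWGint.const_mul _) (hWHint.const_mul _),
      intervalIntegral.integral_const_mul, intervalIntegral.integral_const_mul,
      intervalIntegral.integral_const_mul] at h1
    have h2 : y / 15 * ∫ t in X..2 * X, W t * G t ≤ X * D := by
      calc _ ≤ y / 15 * (15 * (X * D / y)) := by gcongr
        _ = X * D := by field_simp
    have h3 : (k + 1) / (8 * y) * ∫ t in X..2 * X, W t * H t ≤ X * D := by
      calc _ ≤ (k + 1) / (8 * y) * (8 * y * (X * D / (k + 1))) := by gcongr
        _ = X * D := by field_simp
    have h4 : 0 < X * D := by positivity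
    linarith
  refine ⟨T, hT.1, hT.2, ?_, ?_⟩
  · change G T ≤ _
    have h1 : 0 ≤ (k + 1) / (8 * y) * H T := mul_nonneg (by positivity) (hH0 T)
    have h2 : y / 15 * G T ≤ 5 := by linarith
    rw [le_div_iff₀ hy0]
    linarith
  · change H T ≤ _
    have h1 : 0 ≤ y / 15 * G T := mul_nonneg (by positivity) (hG0 T)
    have h2 : (k + 1) / (8 * y) * H T ≤ 5 := by linarith
    rw [div_mul_eq_mul_div, div_le_iff₀ (by positivity)] at h2
    rw [le_div_iff₀ (by positivity)]
    linarith

open Nat in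
lemma primeFactors_factorial_pow {y k : ℕ} (hk : k ≠ 0) :
    (y ! ^ k).primeFactors = (y + 1).primesBelow := by
  rw [Nat.primeFactors_pow _ hk]
  ext p
  rw [Nat.mem_primeFactors, Nat.mem_primesBelow]
  constructor
  · rintro ⟨hp, hd, _⟩
    exact ⟨Nat.lt_succ_of_le ((hp.dvd_factorial).1 hd), hp⟩
  · rintro ⟨hlt, hp⟩
    exact ⟨hp, (hp.dvd_factorial).2 (Nat.le_of_lt_succ hlt), Nat.factorial_ne_zero y⟩

open Nat Complex in
lemma exists_resonant_point_primesBelow {ε : ℂ} (hε : ‖ε‖ = 1) {y : ℕ} (hy : 7 ≤ y) :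
    ∃ T : ℝ, (y : ℝ) ≤ T ∧ Real.log (Real.log T) ≤ 8 * Real.log y ∧
      ∫ u in (0 : ℝ)..1, ‖riemannZeta (1 + I * ((T + u : ℝ) : ℂ)) *
        ∏ p ∈ (y + 1).primesBelow, (1 - (p : ℂ) ^ (-(1 + I * ((T + u : ℝ) : ℂ)))) - 1‖ ^ 2 ≤ 75 / y ∧
      ∑ p ∈ (y + 1).primesBelow, ‖1 - ε * (p : ℂ) ^ (-(I * T))‖ ≤ 1 := by
  set k := y ^ 4 with hk
  set Q := y ! ^ k with hQdef
  have hk0 : k ≠ 0 := by positivity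
  have hy2 : 2 ≤ y ! := le_trans (by omega) (Nat.self_le_factorial y)
  have hyQ : y ≤ Q := (Nat.self_le_factorial y).trans (Nat.le_self_pow hk0 _)
  have hkQ : k + 1 ≤ Q := by
    calc k + 1 ≤ 2 ^ k := Nat.lt_two_pow_self
      _ ≤ Q := Nat.pow_le_pow_left hy2 k
  have hpf : Q.primeFactors = (y + 1).primesBelow := primeFactors_factorial_pow hk0
  have hcard : Q.primeFactors.card ≤ y := by
    rw [hpf]
    have hsub : (y + 1).primesBelow ⊆ Finset.Icc 1 y := fun p hp => by
      rw [Nat.mem_primesBelow] at hp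
      rw [Finset.mem_Icc]
      exact ⟨hp.2.pos, by omega⟩
    simpa using Finset.card_le_card hsub
  obtain ⟨T, hT1, hT2, hint, hsum⟩ := exists_resonant_point hε (Q := Q) (y := y) (k := k)
    (by omega) (by omega) hyQ (fun m hm hmQ => by
      by_contra hmy
      have h1 : m ∣ y ! := Nat.dvd_factorial (by omega) (by omega)
      have h2 := Nat.dvd_gcd (dvd_refl m) (h1.trans (dvd_pow_self _ hk0))
      rw [hmQ] at h2
      have := Nat.dvd_one.1 h2
      omega) (fun p hp => by
      rw [hpf, Nat.mem_primesBelow] at hp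
      exact pow_dvd_pow_of_dvd (Nat.dvd_factorial hp.2.pos (by omega)) k) hkQ hcard
  have hy0 : (0 : ℝ) < y := by exact_mod_cast (by omega : 0 < y)
  have hy7 : (7 : ℝ) ≤ y := by exact_mod_cast hy
  have hQy : (y : ℝ) ≤ Q := by exact_mod_cast hyQ
  have hyT : (y : ℝ) ≤ T := by
    refine le_trans hQy (le_trans ?_ hT1)
    exact le_self_pow₀ (by linarith) (by norm_num)
  refine ⟨T, hyT, ?_, ?_, ?_⟩
  · have hlogQ : Real.log Q ≤ (y : ℝ) ^ 6 := by
      have h1 : Real.log Q = (y : ℝ) ^ 4 * Real.log (y ! : ℕ) := by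
        rw [hQdef, Nat.cast_pow, Real.log_pow, hk]; push_cast; rfl
      have h2 : Real.log (y ! : ℕ) ≤ y * Real.log y := by
        rw [← Real.log_pow]
        refine Real.log_le_log (by exact_mod_cast Nat.factorial_pos y) ?_
        exact_mod_cast Nat.factorial_le_pow y
      have h3 : Real.log y ≤ y := (Real.log_le_sub_one_of_pos hy0).trans (by linarith)
      rw [h1]
      calc (y : ℝ) ^ 4 * Real.log (y ! : ℕ) ≤ (y : ℝ) ^ 4 * (y * y) := by
            gcongr
            exact h2.trans (by gcongr)
        _ = (y : ℝ) ^ 6 := by ring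
    have hT0 : 0 < T := by linarith
    have hlogT : Real.log T ≤ (y : ℝ) ^ 8 := by
      have h1 : Real.log T ≤ Real.log 2 + 30 * Real.log Q := by
        refine (Real.log_le_log hT0 hT2).trans ?_
        rw [Real.log_mul (by norm_num) (by positivity), Real.log_pow]
        push_cast
        exact le_rfl
      have h2 : Real.log 2 ≤ 1 := Real.log_two_lt_d9.le.trans (by norm_num)
      have h3 : (1 : ℝ) ≤ (y : ℝ) ^ 6 := one_le_pow₀ (by linarith)
      have h4 : (49 : ℝ) * y ^ 6 ≤ y ^ 8 := by
        calc (49 : ℝ) * y ^ 6 = 7 ^ 2 * y ^ 6 := by norm_num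
          _ ≤ (y : ℝ) ^ 2 * y ^ 6 := by gcongr
          _ = _ := by ring
      linarith
    have hlogT0 : 0 < Real.log T := Real.log_pos (by linarith)
    calc Real.log (Real.log T) ≤ Real.log ((y : ℝ) ^ 8) := Real.log_le_log hlogT0 hlogT
      _ = 8 * Real.log y := by rw [Real.log_pow]; push_cast; rfl
  · simpa only [eulerError, hpf] using hint
  · rw [hpf] at hsum hcard
    have hterm : ∀ p ∈ (y + 1).primesBelow, ‖1 - ε * (p : ℂ) ^ (-(I * T))‖ = ‖1 - twist ε T p‖ := by
      intro p hp
      have hp' := (Nat.mem_primesBelow.1 hp).2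
      rw [twist, ArithmeticFunction.cardFactors_apply_prime hp', pow_one,
        cpow_def_of_ne_zero (by exact_mod_cast hp'.ne_zero), Complex.natCast_log]
      congr 4
      ring
    rw [Finset.sum_congr rfl hterm]
    have h1 := sq_sum_le_card_mul_sum_sq (s := (y + 1).primesBelow)
      (f := fun p => ‖1 - twist ε T p‖)
    have h2 : (((y + 1).primesBelow).card : ℝ) ≤ y := by exact_mod_cast hcard
    have h3 : (40 : ℝ) * y / (k + 1) ≤ 1 / y := by
      rw [div_le_div_iff₀ (by positivity) hy0, hk]
      push_cast
      have : (49 : ℝ) * y ^ 2 ≤ y ^ 4 := by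
        calc (49 : ℝ) * y ^ 2 = 7 ^ 2 * y ^ 2 := by norm_num
          _ ≤ (y : ℝ) ^ 2 * y ^ 2 := by gcongr
          _ = _ := by ring
      nlinarith [pow_pos hy0 2]
    have h4 : (∑ p ∈ (y + 1).primesBelow, ‖1 - twist ε T p‖) ^ 2 ≤ 1 := by
      calc _ ≤ (((y + 1).primesBelow).card : ℝ) *
              ∑ p ∈ (y + 1).primesBelow, ‖1 - twist ε T p‖ ^ 2 := h1
        _ ≤ y * (1 / y) := by
            gcongr
            exact hsum.trans h3
        _ = 1 := by field_simp
    exact (sq_le_one_iff₀ (Finset.sum_nonneg fun _ _ => norm_nonneg _)).1 h4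

/-- `f` takes values `≥ 1 / (C (1 / log y + u))` at most points `T + u` of short intervals to the
right of suitable `T ≥ y` with `log log T ≤ 8 log y`. -/
def HasResonantPeaks (f : ℝ → ℝ) : Prop :=
  ∃ C r : ℝ, 0 < C ∧ 0 < r ∧ ∀ᶠ y : ℕ in Filter.atTop, ∃ T : ℝ, (y : ℝ) ≤ T ∧
    Real.log (Real.log T) ≤ 8 * Real.log y ∧ ∃ E : ℝ → ℝ, ContinuousOn E (Set.Icc 0 1) ∧
      (∀ u, 0 ≤ E u) ∧ ∫ u in (0 : ℝ)..1, E u ≤ 75 / y ∧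
      ∀ u, 0 ≤ u → u < r → E u < 1 / 4 → 1 / (C * (1 / Real.log y + u)) ≤ f (T + u)

open Complex in
lemma cpow_neg_one_add_add {p : ℕ} (hp : 0 < p) (T u : ℝ) :
    (p : ℂ) ^ (-(1 + I * ((T + u : ℝ) : ℂ))) =
      (p : ℂ) ^ (-(1 + I * u)) * (p : ℂ) ^ (-(I * T)) := by
  rw [← cpow_add _ _ (by exact_mod_cast hp.ne')]
  congr 1
  push_cast
  ring

open Complex in
lemma norm_cpow_neg_I_mul {p : ℕ} (hp : 0 < p) (T : ℝ) : ‖(p : ℂ) ^ (-(I * T))‖ = 1 := by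
  rw [norm_natCast_cpow_neg hp]
  simp

lemma prod_le_exp_mul_prod {S : Finset ℕ} {a b η : ℕ → ℝ} (ha : ∀ p ∈ S, 0 ≤ a p)
    (hb : ∀ p ∈ S, 0 ≤ b p) (h : ∀ p ∈ S, a p ≤ b p * (1 + η p)) (hη : ∑ p ∈ S, η p ≤ 1) :
    ∏ p ∈ S, a p ≤ Real.exp 1 * ∏ p ∈ S, b p := by
  calc ∏ p ∈ S, a p ≤ ∏ p ∈ S, b p * Real.exp (η p) := by
        refine Finset.prod_le_prod ha fun p hp => (h p hp).trans ?_
        have := Real.add_one_le_exp (η p)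
        exact mul_le_mul_of_nonneg_left (by linarith) (hb p hp)
    _ = Real.exp (∑ p ∈ S, η p) * ∏ p ∈ S, b p := by
        rw [Finset.prod_mul_distrib, ← Real.exp_sum, mul_comm]
    _ ≤ _ := by
        have := Finset.prod_nonneg hb
        gcongr

open Complex in
lemma norm_prod_le_of_near_one {S : Finset ℕ} (hS : ∀ p ∈ S, 2 ≤ p) {T : ℝ}
    (hT : ∑ p ∈ S, ‖1 - (p : ℂ) ^ (-(I * T))‖ ≤ 1) (u : ℝ) :
    ‖∏ p ∈ S, (1 - (p : ℂ) ^ (-(1 + I * ((T + u : ℝ) : ℂ))))‖ ≤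
      Real.exp 1 * ∏ p ∈ S, ‖1 - (p : ℂ) ^ (-(1 + I * u))‖ := by
  rw [norm_prod]
  refine prod_le_exp_mul_prod (fun _ _ => norm_nonneg _) (fun _ _ => norm_nonneg _)
    (fun p hp => ?_) hT
  have hp2 := hS p hp
  have hp0 : (2 : ℝ) ≤ p := by exact_mod_cast hp2
  rw [cpow_neg_one_add_add (by omega)]
  set w := (p : ℂ) ^ (-(1 + I * u))
  set z := (p : ℂ) ^ (-(I * T))
  have hw : ‖w‖ ≤ 1 / 2 := by
    rw [norm_natCast_cpow_neg_one_add (by omega)]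
    exact one_div_le_one_div_of_le (by norm_num) hp0
  have hw' := half_le_norm_one_sub hw
  calc ‖1 - w * z‖ = ‖(1 - w) + w * (1 - z)‖ := by congr 1; ring
    _ ≤ ‖1 - w‖ + ‖w‖ * ‖1 - z‖ := by rw [← norm_mul]; exact norm_add_le _ _
    _ ≤ ‖1 - w‖ + ‖1 - w‖ * ‖1 - z‖ := by gcongr; linarith
    _ = _ := by ring

lemma half_le_prod_one_sub_inv_sq (y : ℕ) :
    1 / 2 ≤ ∏ p ∈ (y + 1).primesBelow, (1 - 1 / (p : ℝ) ^ 2) := by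
  have h : ∀ n : ℕ, (1 : ℝ) / 2 ≤ ∏ p ∈ Finset.Icc 2 (n + 1), (1 - 1 / (p : ℝ) ^ 2) := by
    intro n
    have : ∏ p ∈ Finset.Icc 2 (n + 1), (1 - 1 / (p : ℝ) ^ 2) =
        ((n : ℝ) + 2) / (2 * ((n : ℝ) + 1)) := by
      induction n with
      | zero => simp
      | succ n ih =>
        rw [Finset.prod_Icc_succ_top (by omega), ih]
        push_cast
        have h1 : (n : ℝ) + 1 ≠ 0 := by positivity
        have h2 : (n : ℝ) + 1 + 1 ≠ 0 := by positivity
        field_simp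
        ring
    rw [this, div_le_div_iff₀ (by norm_num) (by positivity)]
    linarith
  refine (h y).trans ?_
  have hsub : (y + 1).primesBelow ⊆ Finset.Icc 2 (y + 1) := fun p hp => by
    rw [Nat.mem_primesBelow] at hp
    rw [Finset.mem_Icc]
    exact ⟨hp.2.two_le, by omega⟩
  have hle : ∀ p ∈ Finset.Icc 2 (y + 1), (1 : ℝ) / (p : ℝ) ^ 2 ≤ 1 := fun p hp => by
    have : (1 : ℝ) ≤ p := by exact_mod_cast (by rw [Finset.mem_Icc] at hp; omega : 1 ≤ p)
    rw [div_le_one (by positivity)]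
    exact one_le_pow₀ this
  rw [← Finset.prod_sdiff hsub]
  refine mul_le_of_le_one_left (Finset.prod_nonneg fun p hp => ?_)
    (Finset.prod_le_one (fun p hp => ?_) fun p hp => ?_)
  · linarith [hle p (hsub hp)]
  · linarith [hle p (Finset.sdiff_subset hp)]
  · have : (0 : ℝ) ≤ 1 / (p : ℝ) ^ 2 := by positivity
    linarith

open Complex in
lemma one_le_norm_prod_mul_of_near_neg_one {y : ℕ} {T : ℝ}
    (hT : ∑ p ∈ (y + 1).primesBelow, ‖1 - -1 * (p : ℂ) ^ (-(I * T))‖ ≤ 1) (u : ℝ) :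
    1 ≤ 2 * Real.exp 1 *
      ‖∏ p ∈ (y + 1).primesBelow, (1 - (p : ℂ) ^ (-(1 + I * ((T + u : ℝ) : ℂ))))‖ *
      ∏ p ∈ (y + 1).primesBelow, ‖1 - (p : ℂ) ^ (-(1 + I * u))‖ := by
  have hS : ∀ p ∈ (y + 1).primesBelow, 2 ≤ p := fun p hp => (Nat.mem_primesBelow.1 hp).2.two_le
  have hw : ∀ p ∈ (y + 1).primesBelow, ‖(p : ℂ) ^ (-(1 + I * u))‖ ≤ 1 / 2 := fun p hp => by
    have hp2 := hS p hp
    rw [norm_natCast_cpow_neg_one_add (by omega)]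
    exact one_div_le_one_div_of_le (by norm_num) (by exact_mod_cast hp2)
  have h1 : ∏ p ∈ (y + 1).primesBelow, ‖1 + (p : ℂ) ^ (-(1 + I * u))‖ ≤
      Real.exp 1 * ‖∏ p ∈ (y + 1).primesBelow,
        (1 - (p : ℂ) ^ (-(1 + I * ((T + u : ℝ) : ℂ))))‖ := by
    rw [norm_prod]
    refine prod_le_exp_mul_prod (fun _ _ => norm_nonneg _) (fun _ _ => norm_nonneg _)
      (fun p hp => ?_) hT
    have hp2 := hS p hp
    have hwp := hw p hp
    have hz := norm_cpow_neg_I_mul (show 0 < p by omega) T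
    rw [cpow_neg_one_add_add (by omega)]
    set w := (p : ℂ) ^ (-(1 + I * u))
    set z := (p : ℂ) ^ (-(I * T))
    have hw' := half_le_norm_one_sub (z := w * z) (by rwa [norm_mul, hz, mul_one])
    calc ‖1 + w‖ = ‖(1 - w * z) + w * (1 - -1 * z)‖ := by congr 1; ring
      _ ≤ ‖1 - w * z‖ + ‖w‖ * ‖1 - -1 * z‖ := by rw [← norm_mul]; exact norm_add_le _ _
      _ ≤ ‖1 - w * z‖ + ‖1 - w * z‖ * ‖1 - -1 * z‖ := by gcongr; linarith
      _ = _ := by ring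
  have h2 : (1 : ℝ) / 2 ≤ (∏ p ∈ (y + 1).primesBelow, ‖1 + (p : ℂ) ^ (-(1 + I * u))‖) *
      ∏ p ∈ (y + 1).primesBelow, ‖1 - (p : ℂ) ^ (-(1 + I * u))‖ := by
    refine (half_le_prod_one_sub_inv_sq y).trans ?_
    rw [← Finset.prod_mul_distrib]
    refine Finset.prod_le_prod (fun p hp => ?_) fun p hp => ?_
    · have hp2 := hS p hp
      have : (1 : ℝ) ≤ p := by exact_mod_cast (by omega : 1 ≤ p)
      rw [sub_nonneg, div_le_one (by positivity)]
      exact one_le_pow₀ this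
    · have hp2 := hS p hp
      rw [← norm_mul, show ∀ w : ℂ, (1 + w) * (1 - w) = 1 - w ^ 2 from fun w => by ring]
      have := norm_sub_norm_le (1 : ℂ) (((p : ℂ) ^ (-(1 + I * u))) ^ 2)
      rwa [norm_one, norm_pow, norm_natCast_cpow_neg_one_add (by omega), div_pow, one_pow] at this
  have h3 : 0 ≤ ∏ p ∈ (y + 1).primesBelow, ‖1 - (p : ℂ) ^ (-(1 + I * u))‖ :=
    Finset.prod_nonneg fun _ _ => norm_nonneg _
  have h4 := mul_le_mul_of_nonneg_right h1 h3
  linarith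

open Complex Filter in
lemma hasResonantPeaks_of_sign {ε : ℂ} (hε : ‖ε‖ = 1) {f : ℝ → ℝ}
    (hf : ∃ K : ℝ, 0 < K ∧ ∀ (y : ℕ) (T : ℝ),
      ∑ p ∈ (y + 1).primesBelow, ‖1 - ε * (p : ℂ) ^ (-(I * T))‖ ≤ 1 → ∀ u : ℝ,
      ‖riemannZeta (1 + I * ((T + u : ℝ) : ℂ)) * ∏ p ∈ (y + 1).primesBelow,
        (1 - (p : ℂ) ^ (-(1 + I * ((T + u : ℝ) : ℂ)))) - 1‖ < 1 / 2 →
      1 ≤ K * f (T + u) * ∏ p ∈ (y + 1).primesBelow, ‖1 - (p : ℂ) ^ (-(1 + I * u))‖)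
    (hf0 : ∀ t, 0 ≤ f t) : HasResonantPeaks f := by
  obtain ⟨K, hK, hf⟩ := hf
  obtain ⟨C, r, hC, hr, hprod⟩ := exists_prod_primesBelow_le
  refine ⟨K * C, r, by positivity, hr, ?_⟩
  have hlog : ∀ᶠ y : ℕ in atTop, 1 / r < Real.log y :=
    (Real.tendsto_log_atTop.comp tendsto_natCast_atTop_atTop).eventually_gt_atTop _
  filter_upwards [hlog, eventually_ge_atTop 7] with y hy hy7
  obtain ⟨T, hyT, hloglog, hint, hsum⟩ := exists_resonant_point_primesBelow hε hy7
  have hl0 : 0 < Real.log y := (one_div_pos.2 hr).trans hy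
  have hy0 : (7 : ℝ) ≤ y := by exact_mod_cast hy7
  refine ⟨T, hyT, hloglog, _, ?_, fun u => sq_nonneg _, hint, fun u hu0 hur hE => ?_⟩
  · intro u hu
    have hTu : T + u ≠ 0 := by have := hu.1; exact ne_of_gt (by linarith)
    refine ContinuousAt.continuousWithinAt (((ContinuousAt.sub (ContinuousAt.mul ?_
      (Continuous.continuousAt ?_)) continuousAt_const)).norm.pow 2)
    · exact ContinuousAt.comp (f := fun u : ℝ => T + u)
        (g := fun t : ℝ => riemannZeta (1 + I * (t : ℂ)))
        (continuousAt_riemannZeta_one_add hTu) (by fun_prop)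
    · refine continuous_finsetProd _ fun p hp => continuous_const.sub ?_
      have : (p : ℂ) ≠ 0 := by exact_mod_cast (Nat.mem_primesBelow.1 hp).2.ne_zero
      exact Continuous.const_cpow (by fun_prop) (Or.inl this)
  · have h1 := hf y T hsum u (by
      refine lt_of_pow_lt_pow_left₀ 2 (by norm_num) ?_
      norm_num at hE ⊢
      exact hE)
    have h2 := hprod y hy u (by rwa [abs_of_nonneg hu0])
    rw [abs_of_nonneg hu0] at h2
    rw [div_le_iff₀ (by positivity)]
    have h3 : 0 ≤ K * f (T + u) := mul_nonneg hK.le (hf0 _)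
    calc 1 ≤ K * f (T + u) * (C * (1 / Real.log y + u)) :=
          h1.trans (mul_le_mul_of_nonneg_left h2 h3)
      _ = _ := by ring

open Complex in
lemma hasResonantPeaks_norm_riemannZeta :
    HasResonantPeaks fun t : ℝ => ‖riemannZeta (1 + I * (t : ℂ))‖ := by
  refine hasResonantPeaks_of_sign (ε := 1) norm_one ⟨2 * Real.exp 1, by positivity,
    fun y T hT u hE => ?_⟩ fun _ => norm_nonneg _
  simp only [one_mul] at hT
  have h1 := norm_prod_le_of_near_one
    (fun p hp => (Nat.mem_primesBelow.1 hp).2.two_le) hT u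
  set F := ∏ p ∈ (y + 1).primesBelow, (1 - (p : ℂ) ^ (-(1 + I * ((T + u : ℝ) : ℂ))))
  set Z := riemannZeta (1 + I * ((T + u : ℝ) : ℂ))
  have h2 : 1 / 2 ≤ ‖Z‖ * ‖F‖ := by
    rw [← norm_mul]
    have := norm_sub_norm_le (1 : ℂ) (1 - Z * F)
    rw [norm_one, sub_sub_cancel, norm_sub_rev] at this
    linarith
  have h3 := mul_le_mul_of_nonneg_left h1 (norm_nonneg Z)
  linarith

open Complex in
lemma hasResonantPeaks_norm_riemannZeta_inv :
    HasResonantPeaks fun t : ℝ => ‖riemannZeta (1 + I * (t : ℂ))‖⁻¹ := by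
  refine hasResonantPeaks_of_sign (ε := -1) (by simp) ⟨4 * Real.exp 1, by positivity,
    fun y T hT u hE => ?_⟩ fun _ => by positivity
  have h1 := one_le_norm_prod_mul_of_near_neg_one hT u
  have hG : 0 ≤ ∏ p ∈ (y + 1).primesBelow, ‖1 - (p : ℂ) ^ (-(1 + I * u))‖ :=
    Finset.prod_nonneg fun _ _ => norm_nonneg _
  set F := ∏ p ∈ (y + 1).primesBelow, (1 - (p : ℂ) ^ (-(1 + I * ((T + u : ℝ) : ℂ))))
  set Z := riemannZeta (1 + I * ((T + u : ℝ) : ℂ))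
  have hZ : Z ≠ 0 := riemannZeta_ne_zero_of_one_le_re (by simp)
  have h2 : ‖F‖ ≤ 2 * ‖Z‖⁻¹ := by
    rw [← div_eq_mul_inv, le_div_iff₀ (norm_pos_iff.2 hZ), ← norm_mul, mul_comm]
    have := norm_sub_norm_le (Z * F) 1
    rw [norm_one] at this
    linarith
  have h3 := mul_le_mul_of_nonneg_left (mul_le_mul_of_nonneg_right h2 hG)
    (show 0 ≤ 2 * Real.exp 1 by positivity)
  calc (1 : ℝ) ≤ _ := h1
    _ ≤ _ := by linarith

open MeasureTheory Filter in
/-- Peaks give lower bounds for short interval moments. -/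
lemma HasResonantPeaks.exists_integral_rpow_ge {f : ℝ → ℝ} (hf : HasResonantPeaks f)
    (hf0 : ∀ t, 0 ≤ f t) (hfc : ContinuousOn f (Set.Ioi 0)) {δ : ℝ} (hδ : 0 < δ) :
    ∃ C d : ℝ, 0 < C ∧ 0 < d ∧ ∀ p : ℝ, 0 < p → ∀ᶠ y : ℕ in atTop, ∃ T : ℝ, (y : ℝ) ≤ T ∧
      Real.log (Real.log T) ≤ 8 * Real.log y ∧
      (∫ u in (0 : ℝ)..d, (1 / (C * (1 / Real.log y + u))) ^ p) -
        300 * (Real.log y / C) ^ p / y ≤ ∫ t in T..T + δ, f t ^ p := by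
  obtain ⟨C, r, hC, hr, hev⟩ := hf
  set d := min (δ / 2) (min (r / 2) 1) with hd
  have hd0 : 0 < d := by positivity
  have hdδ : d ≤ δ := (min_le_left _ _).trans (by linarith)
  have hdr : d < r := ((min_le_right _ _).trans (min_le_left _ _)).trans_lt (by linarith)
  have hd1 : d ≤ 1 := (min_le_right _ _).trans (min_le_right _ _)
  refine ⟨C, d, hC, hd0, fun p hp => ?_⟩
  filter_upwards [hev, eventually_ge_atTop 2] with y hy hy2
  obtain ⟨T, hyT, hloglog, E, hEc, hE0, hEint, hpeak⟩ := hy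
  refine ⟨T, hyT, hloglog, ?_⟩
  have hy2' : (2 : ℝ) ≤ y := by exact_mod_cast hy2
  have hT0 : 0 < T := by linarith
  have hl0 : 0 < Real.log y := Real.log_pos (by linarith)
  set L : ℝ → ℝ := fun u => (1 / (C * (1 / Real.log y + u))) ^ p with hL
  set B := (Real.log y / C) ^ p with hB
  have hB0 : 0 ≤ B := by positivity
  have hden : ∀ u, 0 ≤ u → 0 < C * (1 / Real.log y + u) := fun u hu => by positivity
  have hL0 : ∀ u, 0 ≤ u → 0 ≤ L u := fun u hu =>
    Real.rpow_nonneg (one_div_nonneg.2 (hden u hu).le) p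
  have hLB : ∀ u, 0 ≤ u → L u ≤ B := fun u hu => by
    refine Real.rpow_le_rpow (one_div_nonneg.2 (hden u hu).le) ?_ hp.le
    calc 1 / (C * (1 / Real.log y + u)) ≤ 1 / (C * (1 / Real.log y)) :=
          one_div_le_one_div_of_le (by positivity) (by gcongr; linarith)
      _ = Real.log y / C := by field_simp
  have hLc : ContinuousOn L (Set.uIcc 0 d) := by
    rw [Set.uIcc_of_le hd0.le]
    refine ContinuousOn.rpow_const ?_ fun u _ => Or.inr hp.le
    exact continuousOn_const.div (by fun_prop) fun u hu => (hden u hu.1).ne'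
  have hEc' : ContinuousOn E (Set.uIcc 0 d) := hEc.mono (by
    rw [Set.uIcc_of_le hd0.le]; exact Set.Icc_subset_Icc_right hd1)
  have hfp : ContinuousOn (fun t => f t ^ p) (Set.Icc T (T + δ)) :=
    (hfc.mono fun t ht => hT0.trans_le ht.1).rpow_const fun t _ => Or.inr hp.le
  have hfp' : ContinuousOn (fun u => f (T + u) ^ p) (Set.uIcc 0 d) := by
    refine hfp.comp (f := fun u => T + u) (by fun_prop) fun u hu => ?_
    rw [Set.uIcc_of_le hd0.le] at hu
    exact ⟨by linarith [hu.1], by linarith [hu.2]⟩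
  have hpt : ∀ u ∈ Set.Icc 0 d, L u - 4 * B * E u ≤ f (T + u) ^ p := fun u hu => by
    have h1 := hE0 u
    rcases lt_or_ge (E u) (1 / 4) with h | h
    · have h2 : L u ≤ f (T + u) ^ p :=
        Real.rpow_le_rpow (one_div_nonneg.2 (hden u hu.1).le)
          (hpeak u hu.1 (hu.2.trans_lt hdr) h) hp.le
      have : 0 ≤ 4 * B * E u := by positivity
      linarith
    · have h2 := hLB u hu.1
      have h3 : 0 ≤ f (T + u) ^ p := Real.rpow_nonneg (hf0 _) p
      nlinarith
  calc (∫ u in (0 : ℝ)..d, L u) - 300 * B / y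
      ≤ (∫ u in (0 : ℝ)..d, L u) - 4 * B * ∫ u in (0 : ℝ)..d, E u := by
        have h1 : ∫ u in (0 : ℝ)..d, E u ≤ 75 / y := by
          refine le_trans ?_ hEint
          refine intervalIntegral.integral_mono_interval le_rfl hd0.le hd1
            (Eventually.of_forall hE0) ?_
          refine ContinuousOn.intervalIntegrable ?_
          rwa [Set.uIcc_of_le zero_le_one]
        have h2 := mul_le_mul_of_nonneg_left h1 (show 0 ≤ 4 * B by positivity)
        have h3 : 4 * B * (75 / y) = 300 * B / y := by ring
        linarith
    _ = ∫ u in (0 : ℝ)..d, (L u - 4 * B * E u) := by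
        rw [intervalIntegral.integral_sub hLc.intervalIntegrable
          (hEc'.intervalIntegrable.const_mul _), intervalIntegral.integral_const_mul]
    _ ≤ ∫ u in (0 : ℝ)..d, f (T + u) ^ p :=
        intervalIntegral.integral_mono_on hd0.le
          (hLc.intervalIntegrable.sub (hEc'.intervalIntegrable.const_mul _))
          hfp'.intervalIntegrable hpt
    _ = ∫ t in T..T + d, f t ^ p := by
        rw [intervalIntegral.integral_comp_add_left (fun t => f t ^ p) T, add_zero]
    _ ≤ ∫ t in T..T + δ, f t ^ p := by
        refine intervalIntegral.integral_mono_interval le_rfl (by linarith) (by linarith)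
          (Eventually.of_forall fun t => Real.rpow_nonneg (hf0 t) p) ?_
        refine ContinuousOn.intervalIntegrable ?_
        rwa [Set.uIcc_of_le (by linarith)]

open Filter in
lemma tendsto_log_natCast_atTop : Tendsto (fun y : ℕ => Real.log y) atTop atTop :=
  Real.tendsto_log_atTop.comp tendsto_natCast_atTop_atTop

open Filter in
lemma eventually_log_natCast_le_mul {η : ℝ} (hη : 0 < η) :
    ∀ᶠ y : ℕ in atTop, Real.log y ≤ η * y := by
  have h := tendsto_natCast_atTop_atTop (R := ℝ).eventually
    (Real.isLittleO_log_id_atTop.bound hη)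
  filter_upwards [h] with y hy
  simp only [id_eq, Real.norm_eq_abs, Nat.abs_cast] at hy
  exact (le_abs_self _).trans hy

open Filter in
lemma HasResonantPeaks.isOmegaAtTop_integral {f : ℝ → ℝ} (hf : HasResonantPeaks f)
    (hf0 : ∀ t, 0 ≤ f t) (hfc : ContinuousOn f (Set.Ioi 0)) {δ : ℝ} (hδ : 0 < δ) :
    IsOmegaAtTop (fun T => ∫ t in T..(T + δ), f t)
      (fun T => Real.log (Real.log (Real.log T))) := by
  obtain ⟨C, d, hC, hd, h⟩ := hf.exists_integral_rpow_ge hf0 hfc hδ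
  refine ⟨1 / (16 * C), by positivity, ?_⟩
  rw [frequently_atTop]
  intro a
  have hll : Tendsto (fun y : ℕ => Real.log (Real.log y)) atTop atTop :=
    Real.tendsto_log_atTop.comp tendsto_log_natCast_atTop
  obtain ⟨y, ⟨T, hyT, hloglog, hint⟩, hl1, hll1, hll2, hsmall, hya⟩ := ((h 1 one_pos).and
    ((tendsto_log_natCast_atTop.eventually_ge_atTop (Real.exp 1)).and
    ((hll.eventually_ge_atTop (-2 * Real.log d)).and ((hll.eventually_ge_atTop (Real.log 8)).and
    ((eventually_log_natCast_le_mul (show 0 < Real.log 8 / 1200 by positivity)).and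
    (tendsto_natCast_atTop_atTop (R := ℝ).eventually_ge_atTop a)))))).exists
  refine ⟨T, hya.trans hyT, ?_⟩
  simp only [Real.rpow_one] at hint
  set l := Real.log y with hl
  have hl0 : 0 < l := (Real.exp_pos 1).trans_le hl1
  have hy0 : (0 : ℝ) < y := by
    rcases Nat.eq_zero_or_pos y with h0 | h0
    · rw [hl, h0] at hl0; simp at hl0
    · exact_mod_cast h0
  have hlog8 : 0 < Real.log 8 := Real.log_pos (by norm_num)
  have hmain : ∫ u in (0 : ℝ)..d, 1 / (C * (1 / l + u)) = 1 / C * Real.log ((1 / l + d) / (1 / l)) := by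
    have h1 : ∀ u : ℝ, 1 / (C * (1 / l + u)) = 1 / C * (1 / (1 / l + u)) := fun u => by
      rw [one_div_mul_one_div]
    simp_rw [h1]
    rw [intervalIntegral.integral_const_mul,
      intervalIntegral.integral_comp_add_left (fun v => 1 / v) (1 / l), add_zero,
      integral_one_div_of_pos (by positivity) (by positivity)]
  have hlow : Real.log l / 2 ≤ Real.log ((1 / l + d) / (1 / l)) := by
    have h1 : d * l ≤ (1 / l + d) / (1 / l) := by
      rw [div_div_eq_mul_div, div_one, add_mul, one_div_mul_cancel hl0.ne']
      linarith
    have h2 := Real.log_le_log (by positivity) h1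
    rw [Real.log_mul hd.ne' hl0.ne'] at h2
    linarith
  have herr : 300 * (l / C) / y ≤ 1 / C * (Real.log l / 4) := by
    rw [div_le_iff₀ hy0]
    calc 300 * (l / C) = 1 / C * (300 * l) := by ring
      _ ≤ 1 / C * (300 * (Real.log 8 / 1200 * y)) := by gcongr
      _ = 1 / C * (Real.log 8 / 4 * y) := by ring
      _ ≤ 1 / C * (Real.log l / 4 * y) := by gcongr
      _ = _ := by ring
  rw [hmain] at hint
  have hlow' := mul_le_mul_of_nonneg_left hlow (show 0 ≤ 1 / C by positivity)
  have hge : 1 / C * (Real.log l / 4) ≤ ∫ t in T..T + δ, f t := by linarith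
  have hlT : l ≤ Real.log T := Real.log_le_log hy0 hyT
  have hlogT : 1 ≤ Real.log (Real.log T) := by
    rw [Real.le_log_iff_exp_le (hl0.trans_le hlT)]
    exact hl1.trans hlT
  have hlll : Real.log (Real.log (Real.log T)) ≤ 2 * Real.log l := by
    calc _ ≤ Real.log (8 * l) := Real.log_le_log (by linarith) hloglog
      _ = Real.log 8 + Real.log l := Real.log_mul (by norm_num) hl0.ne'
      _ ≤ _ := by linarith
  have hlll0 : 0 ≤ Real.log (Real.log (Real.log T)) := Real.log_nonneg hlogT
  rw [abs_of_nonneg hlll0]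
  refine lt_of_lt_of_le ?_ (hge.trans (le_abs_self _))
  calc 1 / (16 * C) * Real.log (Real.log (Real.log T)) ≤ 1 / (16 * C) * (2 * Real.log l) := by gcongr
    _ = 1 / C * (Real.log l / 8) := by field_simp; ring
    _ < 1 / C * (Real.log l / 4) := by
        have : 0 < Real.log l := hlog8.trans_le hll2
        gcongr
        norm_num

open Filter in
lemma HasResonantPeaks.isOmegaAtTop_integral_rpow {f : ℝ → ℝ} (hf : HasResonantPeaks f)
    (hf0 : ∀ t, 0 ≤ f t) (hfc : ContinuousOn f (Set.Ioi 0)) {δ : ℝ} (hδ : 0 < δ) {p : ℝ}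
    (hp : 1 < p) :
    IsOmegaAtTop (fun T => ∫ t in T..(T + δ), f t ^ p)
      (fun T => Real.log (Real.log T) ^ (p - 1)) := by
  obtain ⟨C, d, hC, hd, h⟩ := hf.exists_integral_rpow_ge hf0 hfc hδ
  have hp0 : 0 < p := by linarith
  set A := (1 / (2 * C)) ^ p with hA
  have hA0 : 0 < A := by positivity
  refine ⟨A / (4 * 8 ^ (p - 1)), by positivity, ?_⟩
  rw [frequently_atTop]
  intro a
  obtain ⟨y, ⟨T, hyT, hloglog, hint⟩, hl1, hld, hsmall, hya⟩ := ((h p hp0).and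
    ((tendsto_log_natCast_atTop.eventually_ge_atTop (Real.exp 1)).and
    ((tendsto_log_natCast_atTop.eventually_ge_atTop (1 / d)).and
    ((eventually_log_natCast_le_mul (show 0 < A * C ^ p / 600 by positivity)).and
    (tendsto_natCast_atTop_atTop (R := ℝ).eventually_ge_atTop a))))).exists
  refine ⟨T, hya.trans hyT, ?_⟩
  set l := Real.log y with hl
  have hl0 : 0 < l := (Real.exp_pos 1).trans_le hl1
  have hy0 : (0 : ℝ) < y := by
    rcases Nat.eq_zero_or_pos y with h0 | h0
    · rw [hl, h0] at hl0; simp at hl0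
    · exact_mod_cast h0
  have hκd : 1 / l ≤ d := by rwa [one_div_le hl0 hd]
  have hlp : l ^ p = l ^ (p - 1) * l := by
    rw [Real.rpow_sub_one hl0.ne']; field_simp
  have hden : ∀ u, 0 ≤ u → 0 < C * (1 / l + u) := fun u hu => by positivity
  have hcont : ContinuousOn (fun u => (1 / (C * (1 / l + u))) ^ p) (Set.Icc 0 d) := by
    refine ContinuousOn.rpow_const ?_ fun u _ => Or.inr hp0.le
    exact continuousOn_const.div (by fun_prop) fun u hu => (hden u hu.1).ne'
  have hmain : A * l ^ (p - 1) ≤ ∫ u in (0 : ℝ)..d, (1 / (C * (1 / l + u))) ^ p := by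
    calc A * l ^ (p - 1) = ∫ _ in (0 : ℝ)..1 / l, (l / (2 * C)) ^ p := by
          rw [intervalIntegral.integral_const, sub_zero, smul_eq_mul, div_eq_mul_one_div l,
            Real.mul_rpow hl0.le (by positivity), hlp, ← hA]
          field_simp
      _ ≤ ∫ u in (0 : ℝ)..1 / l, (1 / (C * (1 / l + u))) ^ p := by
          refine intervalIntegral.integral_mono_on (by positivity)
            (continuous_const.intervalIntegrable _ _) ?_ fun u hu => ?_
          · refine ContinuousOn.intervalIntegrable ?_
            rw [Set.uIcc_of_le (by positivity)]
            exact hcont.mono (Set.Icc_subset_Icc_right hκd)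
          · refine Real.rpow_le_rpow (by positivity) ?_ hp0.le
            calc l / (2 * C) = 1 / (C * (1 / l + 1 / l)) := by field_simp; norm_num
              _ ≤ _ := one_div_le_one_div_of_le (hden u hu.1) (by gcongr; exact hu.2)
      _ ≤ _ := by
          refine intervalIntegral.integral_mono_interval le_rfl (by positivity) hκd ?_ ?_
          · rw [EventuallyLE, MeasureTheory.ae_restrict_iff' measurableSet_Ioc]
            exact Eventually.of_forall fun u hu =>
              Real.rpow_nonneg (one_div_nonneg.2 (hden u hu.1.le).le) p
          · refine ContinuousOn.intervalIntegrable ?_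
            rwa [Set.uIcc_of_le hd.le]
  have herr : 300 * (l / C) ^ p / y ≤ A * l ^ (p - 1) / 2 := by
    rw [div_le_iff₀ hy0, Real.div_rpow hl0.le hC.le, hlp]
    have hCp : 0 < C ^ p := by positivity
    calc 300 * (l ^ (p - 1) * l / C ^ p) = 300 * l ^ (p - 1) / C ^ p * l := by ring
      _ ≤ 300 * l ^ (p - 1) / C ^ p * (A * C ^ p / 600 * y) := by gcongr
      _ = _ := by field_simp; norm_num
  have hge : A * l ^ (p - 1) / 2 ≤ ∫ t in T..T + δ, f t ^ p := by linarith
  have hlT : l ≤ Real.log T := Real.log_le_log hy0 hyT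
  have hlogT : 1 ≤ Real.log (Real.log T) := by
    rw [Real.le_log_iff_exp_le (hl0.trans_le hlT)]
    exact hl1.trans hlT
  rw [abs_of_nonneg (Real.rpow_nonneg (by linarith) _)]
  refine lt_of_lt_of_le ?_ (hge.trans (le_abs_self _))
  calc A / (4 * 8 ^ (p - 1)) * Real.log (Real.log T) ^ (p - 1)
      ≤ A / (4 * 8 ^ (p - 1)) * (8 * l) ^ (p - 1) := by
        gcongr
    _ = A * l ^ (p - 1) / 4 := by
        rw [Real.mul_rpow (by norm_num) hl0.le]
        field_simp
    _ < A * l ^ (p - 1) / 2 := by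
        have : 0 < A * l ^ (p - 1) := by positivity
        linarith

theorem theorem8 (δ : ℝ) (hδ : 0 < δ) :
    (IsOmegaAtTop (fun T : ℝ => ∫ t in T..(T + δ), ‖riemannZeta (1 + Complex.I * (t : ℂ))‖)
        (fun T : ℝ => Real.log (Real.log (Real.log T))) ∧
      IsOmegaAtTop (fun T : ℝ => ∫ t in T..(T + δ), ‖riemannZeta (1 + Complex.I * (t : ℂ))‖⁻¹)
        (fun T : ℝ => Real.log (Real.log (Real.log T)))) ∧
    (∀ p : ℝ, 1 < p →
      IsOmegaAtTop
        (fun T : ℝ => ∫ t in T..(T + δ), ‖riemannZeta (1 + Complex.I * (t : ℂ))‖ ^ p)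
        (fun T : ℝ => Real.log (Real.log T) ^ (p - 1)) ∧
      IsOmegaAtTop
        (fun T : ℝ => ∫ t in T..(T + δ), ‖riemannZeta (1 + Complex.I * (t : ℂ))‖ ^ (-p))
        (fun T : ℝ => Real.log (Real.log T) ^ (p - 1))) := by
  have hc : ContinuousOn (fun t : ℝ => ‖riemannZeta (1 + Complex.I * (t : ℂ))‖) (Set.Ioi 0) :=
    fun t ht => (continuousAt_riemannZeta_one_add (ne_of_gt ht)).norm.continuousWithinAt
  have hci : ContinuousOn (fun t : ℝ => ‖riemannZeta (1 + Complex.I * (t : ℂ))‖⁻¹) (Set.Ioi 0) :=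
    hc.inv₀ fun t _ => norm_ne_zero_iff.2 (riemannZeta_ne_zero_of_one_le_re (by simp))
  have h0 : ∀ t : ℝ, 0 ≤ ‖riemannZeta (1 + Complex.I * (t : ℂ))‖ := fun _ => norm_nonneg _
  have h0i : ∀ t : ℝ, 0 ≤ ‖riemannZeta (1 + Complex.I * (t : ℂ))‖⁻¹ := fun t =>
    inv_nonneg.2 (h0 t)
  refine ⟨⟨hasResonantPeaks_norm_riemannZeta.isOmegaAtTop_integral h0 hc hδ,
    hasResonantPeaks_norm_riemannZeta_inv.isOmegaAtTop_integral h0i hci hδ⟩, fun p hp =>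
    ⟨hasResonantPeaks_norm_riemannZeta.isOmegaAtTop_integral_rpow h0 hc hδ hp, ?_⟩⟩
  have h := hasResonantPeaks_norm_riemannZeta_inv.isOmegaAtTop_integral_rpow h0i hci hδ hp
  simp_rw [Real.inv_rpow (h0 _), ← Real.rpow_neg (h0 _)] at h
  exact h
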